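/- Work in $L^2(0,2\pi)$ (complex-valued functions) with the inner product $\langle f,g\rangle=\int_0^{2\pi}\overline{f(x)}\,g(x)\,dx$, and let $\psi_n(x)=(2\pi)^{-1/2}e^{-inx}$ for $n\in\mathbb Z$. For $K\in L^2(0,2\pi)$ let $P_{1,K}$ be the operator in $L^2(0,2\pi)$ with domain $\{f\in H^1(0,2\pi) : f(0)=f(2\pi)\}$ and $(P_{1,K}f)(x)=if'(x)+f(2\pi)K(x)$. The algebraic multiplicity of an eigenvalue $\lambda$ of $P_{1,K}$ is the dimension of its root space $\{f : (P_{1,K}-\lambda)^kf=0\text{ for some }k\in\mathbb N\}$. For $N\in\mathbb N$ and $b>0$ put $\mathcal R_{N,b}=\{z\in\mathbb C : |\operatorname{Re}z|\le N+\tfrac12,\ |\operatorname{Im}z|\le b\}$. **Theorem.** Let $K\in L^2(0,2\pi)$. There exist $N_0\in\mathbb N$ and $b_0>0$ such that for every $N\ge N_0$ and every $b\ge b_0$: (i) the rectangle $\mathcal R_{N,b}$ contains exactly $2N+1$ eigenvalues of $P_{1,K}$, counted with algebraic multiplicity; (ii) for each $n\in\mathbb Z$ with $|n|>N$ and $\langle\psi_n,K\rangle\ne0$,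 the open disk $\{z : |z-n|<|\langle\psi_n,K\rangle|\}$ contains exactly one eigenvalue of $P_{1,K}$, and this eigenvalue has algebraic multiplicity one; (iii) for each $n\in\mathbb Z$ with $|n|>N$ and $\langle\psi_n,K\rangle=0$, the number $n$ is an eigenvalue of $P_{1,K}$ of algebraic multiplicity one. Moreover, this describes all eigenvalues of $P_{1,K}$: every eigenvalue lies in $\mathcal R_{N,b}$, or in one of the disks in (ii), or is one of the integers $n$ in (iii). -/

import Mathlib

open MeasureTheory Set

noncomputable section

/-! ### Unbounded operators: eigenvalues, root spaces, algebraic multiplicity -/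

section RootSpaces

/-- `lam` is an eigenvalue of the (possibly unbounded) operator `A`: there is a nonzero vector `f`
in the domain of `A` with `A f = lam f`. -/
def IsEigenvalue {H : Type*} [AddCommGroup H] [Module ℂ H] (A : H →ₗ.[ℂ] H) (lam : ℂ) : Prop :=
  ∃ f : A.domain, f ≠ 0 ∧ A f = lam • (f : H)

/-- `ker ((A - lam) ^ k)` with the natural domain of the power: `f` lies in
`ker ((A - lam) ^ (k + 1))` iff `f ∈ dom A` and `(A - lam) f ∈ ker ((A - lam) ^ k)`. -/
def kerPow {H : Type*} [AddCommGroup H] [Module ℂ H] (A : H →ₗ.[ℂ] H) (lam : ℂ) :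
    ℕ → Submodule ℂ H
  | 0 => ⊥
  | k + 1 =>
    { carrier := {f | ∃ hf : f ∈ A.domain, A ⟨f, hf⟩ - lam • f ∈ kerPow A lam k}
      add_mem' := by
        rintro f g ⟨hf, hf'⟩ ⟨hg, hg'⟩
        refine ⟨A.domain.add_mem hf hg, ?_⟩
        have h : A ⟨f + g, A.domain.add_mem hf hg⟩ = A ⟨f, hf⟩ + A ⟨g, hg⟩ :=
          A.map_add ⟨f, hf⟩ ⟨g, hg⟩
        rw [h, smul_add, add_sub_add_comm]
        exact add_mem hf' hg'
      zero_mem' := by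
        refine ⟨A.domain.zero_mem, ?_⟩
        have h : A ⟨0, A.domain.zero_mem⟩ = 0 := A.map_zero
        rw [h, smul_zero, sub_zero]
        exact zero_mem _
      smul_mem' := by
        rintro c f ⟨hf, hf'⟩
        refine ⟨A.domain.smul_mem c hf, ?_⟩
        have h : A ⟨c • f, A.domain.smul_mem c hf⟩ = c • A ⟨f, hf⟩ := A.map_smul c ⟨f, hf⟩
        rw [h, smul_comm lam c f, ← smul_sub]
        exact Submodule.smul_mem _ c hf' }

theorem kerPow_le_succ {H : Type*} [AddCommGroup H] [Module ℂ H] (A : H →ₗ.[ℂ] H) (lam : ℂ)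
    (k : ℕ) : kerPow A lam k ≤ kerPow A lam (k + 1) := by
  induction k with
  | zero => exact bot_le
  | succ k ih =>
    rintro f ⟨hf, hf'⟩
    exact ⟨hf, ih hf'⟩

theorem kerPow_mono {H : Type*} [AddCommGroup H] [Module ℂ H] (A : H →ₗ.[ℂ] H) (lam : ℂ) :
    Monotone (kerPow A lam) :=
  monotone_nat_of_le_succ (kerPow_le_succ A lam)

/-- The root space of `A` at `lam`: all `f` with `(A - lam) ^ k f = 0` for some `k`. -/
def rootSpace {H : Type*} [AddCommGroup H] [Module ℂ H] (A : H →ₗ.[ℂ] H) (lam : ℂ) :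
    Submodule ℂ H where
  carrier := {f | ∃ k : ℕ, f ∈ kerPow A lam k}
  add_mem' := by
    rintro f g ⟨k, hk⟩ ⟨l, hl⟩
    exact ⟨max k l, add_mem (kerPow_mono A lam (le_max_left k l) hk)
      (kerPow_mono A lam (le_max_right k l) hl)⟩
  zero_mem' := ⟨0, zero_mem _⟩
  smul_mem' := by
    rintro c f ⟨k, hk⟩
    exact ⟨k, Submodule.smul_mem _ c hk⟩

/-- The algebraic multiplicity: the dimension (a cardinal) of the root space. -/
def algMult {H : Type*} [AddCommGroup H] [Module ℂ H] (A : H →ₗ.[ℂ] H) (lam : ℂ) : Cardinal :=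
  Module.rank ℂ (rootSpace A lam)

end RootSpaces

/-! ### The Hilbert space `L²(0, 2π)` and the Sobolev space `H¹(0, 2π)` -/

/-- Lebesgue measure on `(0, 2π)`. -/
abbrev mu : Measure ℝ := volume.restrict (Ioo 0 (2 * Real.pi))

/-- The complex Hilbert space `L²(0, 2π)`. -/
abbrev L2 : Type := Lp ℂ 2 mu

/-- `g` is the weak derivative of `f` on `(0, 2π)`. -/
def HasWeakDeriv (f g : L2) : Prop :=
  ∀ φ : ℝ → ℝ, ContDiff ℝ (⊤ : ℕ∞) φ → HasCompactSupport φ →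
    tsupport φ ⊆ Ioo 0 (2 * Real.pi) →
    ∫ x, deriv φ x • f x ∂mu = - ∫ x, φ x • g x ∂mu

/-- `F` is a representative of `f` that is continuous on `[0, 2π]`; the boundary values `f(0)` and
`f(2π)` of `f ∈ H¹(0, 2π)` are `F 0` and `F (2π)`. -/
def IsContRep (f : L2) (F : ℝ → ℂ) : Prop :=
  ContinuousOn F (Icc 0 (2 * Real.pi)) ∧ f =ᵐ[mu] F

theorem L2.integrable (f : L2) : Integrable f mu :=
  (Lp.memLp f).integrable (by norm_num)

theorem L2.integrable_smul (f : L2) {φ : ℝ → ℝ} (hφ : Continuous φ) (hs : HasCompactSupport φ) :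
    Integrable (fun x => φ x • f x) mu := by
  obtain ⟨C, hC⟩ := hφ.bounded_above_of_compact_support hs
  exact f.integrable.bdd_smul C hφ.aestronglyMeasurable (Filter.Eventually.of_forall hC)

theorem HasWeakDeriv.zero : HasWeakDeriv 0 0 := by
  intro φ _ _ _
  have h (ψ : ℝ → ℝ) : ∫ x, ψ x • (0 : L2) x ∂mu = 0 := by
    apply integral_eq_zero_of_ae
    filter_upwards [Lp.coeFn_zero ℂ 2 mu] with x hx
    rw [hx, Pi.zero_apply, smul_zero]
  rw [h, h, neg_zero]

theorem L2.integral_smul_add (f₁ f₂ : L2) {φ : ℝ → ℝ} (hφ : Continuous φ)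
    (hs : HasCompactSupport φ) : ∫ x, φ x • (f₁ + f₂ : L2) x ∂mu =
      ∫ x, φ x • f₁ x ∂mu + ∫ x, φ x • f₂ x ∂mu := by
  rw [← integral_add (f₁.integrable_smul hφ hs) (f₂.integrable_smul hφ hs)]
  apply integral_congr_ae
  filter_upwards [Lp.coeFn_add f₁ f₂] with x hx
  rw [hx, Pi.add_apply, smul_add]

theorem L2.integral_smul_smul (c : ℂ) (f : L2) (φ : ℝ → ℝ) :
    ∫ x, φ x • (c • f : L2) x ∂mu = c * ∫ x, φ x • f x ∂mu := by
  rw [← integral_const_mul]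
  apply integral_congr_ae
  filter_upwards [Lp.coeFn_smul c f] with x hx
  rw [hx, Pi.smul_apply, smul_eq_mul, mul_smul_comm]

theorem HasWeakDeriv.add {f₁ g₁ f₂ g₂ : L2} (h₁ : HasWeakDeriv f₁ g₁) (h₂ : HasWeakDeriv f₂ g₂) :
    HasWeakDeriv (f₁ + f₂) (g₁ + g₂) := by
  intro φ hφ hs ht
  have hd : Continuous (deriv φ) := hφ.continuous_deriv (by simp)
  rw [L2.integral_smul_add _ _ hd hs.deriv, L2.integral_smul_add _ _ hφ.continuous hs,
    h₁ φ hφ hs ht, h₂ φ hφ hs ht, neg_add]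

theorem HasWeakDeriv.smul (c : ℂ) {f g : L2} (h : HasWeakDeriv f g) :
    HasWeakDeriv (c • f) (c • g) := by
  intro φ hφ hs ht
  rw [L2.integral_smul_smul, L2.integral_smul_smul, h φ hφ hs ht, mul_neg]

theorem HasWeakDeriv.unique {f g₁ g₂ : L2} (h₁ : HasWeakDeriv f g₁) (h₂ : HasWeakDeriv f g₂) :
    g₁ = g₂ := by
  have key : ∀ᵐ x ∂(volume : Measure ℝ), x ∈ Ioo 0 (2 * Real.pi) → g₁ x - g₂ x = 0 := by
    apply isOpen_Ioo.ae_eq_zero_of_integral_contDiff_smul_eq_zero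
    · have : IntegrableOn (fun x => g₁ x - g₂ x) (Ioo 0 (2 * Real.pi)) volume :=
        g₁.integrable.sub g₂.integrable
      exact this.locallyIntegrableOn
    · intro φ hφ hs ht
      have e : ∫ x, φ x • (g₁ x - g₂ x) = ∫ x, φ x • (g₁ x - g₂ x) ∂mu := by
        refine (setIntegral_eq_integral_of_forall_compl_eq_zero fun x hx => ?_).symm
        rw [image_eq_zero_of_notMem_tsupport fun h => hx (ht h), zero_smul]
      rw [e]
      simp_rw [smul_sub]
      rw [integral_sub (g₁.integrable_smul hφ.continuous hs)
        (g₂.integrable_smul hφ.continuous hs), sub_eq_zero]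
      exact neg_injective ((h₁ φ hφ hs ht).symm.trans (h₂ φ hφ hs ht))
  apply Lp.ext
  rw [← ae_restrict_iff' measurableSet_Ioo] at key
  filter_upwards [key] with x hx
  exact sub_eq_zero.mp hx

theorem IsContRep.zero : IsContRep 0 0 :=
  ⟨continuousOn_const, Lp.coeFn_zero ℂ 2 mu⟩

theorem IsContRep.add {f₁ f₂ : L2} {F₁ F₂ : ℝ → ℂ} (h₁ : IsContRep f₁ F₁)
    (h₂ : IsContRep f₂ F₂) : IsContRep (f₁ + f₂) (F₁ + F₂) :=
  ⟨h₁.1.add h₂.1, (Lp.coeFn_add f₁ f₂).trans (h₁.2.add h₂.2)⟩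

theorem IsContRep.smul (c : ℂ) {f : L2} {F : ℝ → ℂ} (h : IsContRep f F) :
    IsContRep (c • f) (c • F) :=
  ⟨h.1.const_smul c, (Lp.coeFn_smul c f).trans (h.2.const_smul c)⟩

theorem IsContRep.unique {f : L2} {F₁ F₂ : ℝ → ℂ} (h₁ : IsContRep f F₁) (h₂ : IsContRep f F₂) :
    EqOn F₁ F₂ (Icc 0 (2 * Real.pi)) := by
  refine Measure.eqOn_Icc_of_ae_eq volume (by positivity) ?_ h₁.1 h₂.1
  rw [← restrict_Ioo_eq_restrict_Icc]
  exact h₁.2.symm.trans h₂.2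

/-- The Sobolev space `H¹(0, 2π)`. -/
def H1 : Submodule ℂ L2 where
  carrier := {f | ∃ g : L2, HasWeakDeriv f g}
  add_mem' := by
    rintro f₁ f₂ ⟨g₁, h₁⟩ ⟨g₂, h₂⟩
    exact ⟨g₁ + g₂, h₁.add h₂⟩
  zero_mem' := ⟨0, HasWeakDeriv.zero⟩
  smul_mem' := by
    rintro c f ⟨g, h⟩
    exact ⟨c • g, h.smul c⟩

/-- `{f ∈ H¹(0, 2π) | f(0) = f(2π)}`. -/
def domP : Submodule ℂ L2 where
  carrier := {f | f ∈ H1 ∧ ∃ F : ℝ → ℂ, IsContRep f F ∧ F 0 = F (2 * Real.pi)}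
  add_mem' := by
    rintro f₁ f₂ ⟨h₁, F₁, hF₁, e₁⟩ ⟨h₂, F₂, hF₂, e₂⟩
    exact ⟨H1.add_mem h₁ h₂, F₁ + F₂, hF₁.add hF₂, by simp [e₁, e₂]⟩
  zero_mem' := ⟨H1.zero_mem, 0, IsContRep.zero, rfl⟩
  smul_mem' := by
    rintro c f ⟨h, F, hF, e⟩
    exact ⟨H1.smul_mem c h, c • F, hF.smul c, by simp [e]⟩

/-- The weak derivative `f'` of `f ∈ dom P`. -/
def weakDeriv (f : domP) : L2 := f.2.1.choose

theorem weakDeriv_spec (f : domP) : HasWeakDeriv f (weakDeriv f) := f.2.1.choose_spec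

/-- The boundary value `f(2π)` of `f ∈ dom P`. -/
def endValue (f : domP) : ℂ := f.2.2.choose (2 * Real.pi)

theorem endValue_eq (f : domP) {F : ℝ → ℂ} (hF : IsContRep f F) :
    endValue f = F (2 * Real.pi) :=
  f.2.2.choose_spec.1.unique hF ⟨by positivity, le_rfl⟩

/-- The operator `(P_{1,K} f)(x) = i f'(x) + f(2π) K(x)` in `L²(0, 2π)` with domain
`{f ∈ H¹(0, 2π) | f(0) = f(2π)}`. -/
def P1 (K : L2) : L2 →ₗ.[ℂ] L2 where
  domain := domP
  toFun :=
    { toFun := fun f => Complex.I • weakDeriv f + endValue f • K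
      map_add' := by
        intro f g
        have h₁ : weakDeriv (f + g) = weakDeriv f + weakDeriv g :=
          (weakDeriv_spec (f + g)).unique ((weakDeriv_spec f).add (weakDeriv_spec g))
        have h₂ : endValue (f + g) = endValue f + endValue g :=
          endValue_eq (f + g) (f.2.2.choose_spec.1.add g.2.2.choose_spec.1)
        rw [h₁, h₂, smul_add, add_smul, add_add_add_comm]
      map_smul' := by
        intro c f
        have h₁ : weakDeriv (c • f) = c • weakDeriv f :=
          (weakDeriv_spec (c • f)).unique ((weakDeriv_spec f).smul c)
        have h₂ : endValue (c • f) = c * endValue f :=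
          endValue_eq (c • f) (f.2.2.choose_spec.1.smul c)
        rw [h₁, h₂, RingHom.id_apply, smul_add, smul_comm Complex.I c, mul_smul] }

/-- `ψ_n(x) = (2π)^{-1/2} e^{-inx}` as a function. -/
def psiFun (n : ℤ) (x : ℝ) : ℂ :=
  ((1 / Real.sqrt (2 * Real.pi) : ℝ) : ℂ) * Complex.exp (-(Complex.I * n * x))

theorem psiFun_memLp (n : ℤ) : MemLp (psiFun n) 2 mu := by
  have hc : Continuous (psiFun n) := by unfold psiFun; fun_prop
  refine MemLp.of_bound hc.aestronglyMeasurable (1 / Real.sqrt (2 * Real.pi)) ?_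
  refine Filter.Eventually.of_forall fun x => ?_
  have h : ‖Complex.exp (-(Complex.I * n * x))‖ = 1 := by
    rw [Complex.norm_exp]
    simp
  rw [psiFun, norm_mul, h, mul_one, Complex.norm_real, Real.norm_of_nonneg (by positivity)]

/-- `ψ_n` as an element of `L²(0, 2π)`. -/
def psi (n : ℤ) : L2 := (psiFun_memLp n).toLp (psiFun n)

/-- The closed rectangle `{z | |Re z| ≤ N + 1/2, |Im z| ≤ b}`. -/
def rect (N : ℕ) (b : ℝ) : Set ℂ := {z | |z.re| ≤ (N : ℝ) + 1 / 2 ∧ |z.im| ≤ b}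

end

noncomputable section

/-! ### The finite Laplace transform -/

/-! Put `lap f z = ∫ e^{izt} f(t) dt` and `D(z) = e^{2πiz} - 1 - i lap K z` (`charFn`). If `f` is in
the domain and `c = f(2π)`, integration by parts turns `(P - λ)f = g` into `lap g z = (z - λ) lap f
z + i c D(z)`. At `z = λ` this gives `lap g λ = i c D(λ)`, and variation of constants shows that
this condition also suffices for solvability. So the eigenvalues are the zeros of the entire
function `D`, each eigenspace is a line, and a Jordan chain has transforms `-i D(z)/(z - λ)^(j+1)`.
The chain continues exactly while these vanish at `λ`, so algebraic multiplicity equals order of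
vanishing (`algMult_P1`).

It remains to locate zeros. A Riemann–Lebesgue lemma uniform in all complex directions, `lap K z =
o(1 + |e^{2πiz}|)`, forces the large zeros to lie near integers, uniformly for all `sK` with `|s| ≤
1`. Near a large integer `n` one has `D' ≈ 2πi`, so there is exactly one zero and it is simple;
since `|D(n)| = √(2π) |⟨ψ_n, K⟩|`, its distance to `n` is at most `|⟨ψ_n, K⟩|/2`
(`exists_local_zeros`).

The remaining zeros are counted by deforming `K` to `0` through `sK`. No zero enters an annulus
between consecutive integer radii, and Jensen's formula on its two boundary circles expresses the
count as a continuous function of `s`, hence a constant (`zeroCount_add_eq`). At `s = 0` the zeros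
are the `2N + 1` integers in the disk. -/

/-- The finite Laplace transform `z ↦ ∫₀^{2π} e^{izt} h(t) dt`. -/
def lap (h : ℝ → ℂ) (z : ℂ) : ℂ := ∫ t, Complex.exp (Complex.I * z * t) * h t ∂mu

/-- The growth majorant `1 + |e^{2πiz}|` of `lap h z`. -/
def growth (z : ℂ) : ℝ := 1 + Real.exp (-(2 * Real.pi * z.im))

theorem growth_pos (z : ℂ) : 0 < growth z := by unfold growth; positivity

theorem norm_exp_I_mul (z : ℂ) (t : ℝ) :
    ‖Complex.exp (Complex.I * z * t)‖ = Real.exp (-(z.im * t)) := by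
  rw [Complex.norm_exp]; simp

/-- The modulus `e^{-t Im z}` is monotone in `t`, hence bounded by the sum of its endpoint values
`1` and `|e^{2πiz}|`. -/
theorem norm_exp_le_growth (z : ℂ) {t : ℝ} (ht : t ∈ Icc 0 (2 * Real.pi)) :
    ‖Complex.exp (Complex.I * z * t)‖ ≤ growth z := by
  rw [norm_exp_I_mul, growth]
  rcases le_total 0 z.im with h | h
  · have : Real.exp (-(z.im * t)) ≤ 1 := Real.exp_le_one_iff.2 (by nlinarith [ht.1])
    linarith [Real.exp_pos (-(2 * Real.pi * z.im))]
  · have : Real.exp (-(z.im * t)) ≤ Real.exp (-(2 * Real.pi * z.im)) :=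
      Real.exp_le_exp.2 (by nlinarith [ht.2])
    linarith

theorem norm_exp_le_growth_ae (z : ℂ) :
    ∀ᵐ t : ℝ ∂mu, ‖Complex.exp (Complex.I * z * t)‖ ≤ growth z := by
  filter_upwards [ae_restrict_mem measurableSet_Ioo] with t ht
  exact norm_exp_le_growth z (Ioo_subset_Icc_self ht)

theorem continuous_exp_I_mul (z : ℂ) : Continuous fun t : ℝ => Complex.exp (Complex.I * z * t) := by
  fun_prop

theorem integrable_exp_mul {h : ℝ → ℂ} (hh : Integrable h mu) (z : ℂ) :
    Integrable (fun t : ℝ => Complex.exp (Complex.I * z * t) * h t) mu :=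
  hh.bdd_mul (continuous_exp_I_mul z).aestronglyMeasurable (norm_exp_le_growth_ae z)

theorem integral_mu_eq {E : Type*} [NormedAddCommGroup E] [NormedSpace ℝ E] (f : ℝ → E) :
    ∫ t, f t ∂mu = ∫ t in (0 : ℝ)..2 * Real.pi, f t := by
  rw [intervalIntegral.integral_of_le (by positivity), integral_Ioc_eq_integral_Ioo]

theorem integrable_mu_iff {E : Type*} [NormedAddCommGroup E] (f : ℝ → E) :
    Integrable f mu ↔ IntervalIntegrable f volume 0 (2 * Real.pi) := by
  rw [intervalIntegrable_iff_integrableOn_Ioo_of_le (by positivity)]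
  rfl

theorem Continuous.integrable_mu {E : Type*} [NormedAddCommGroup E] {f : ℝ → E}
    (hf : Continuous f) : Integrable f mu :=
  (integrable_mu_iff f).2 (hf.intervalIntegrable _ _)

theorem lap_congr {f g : ℝ → ℂ} (h : f =ᵐ[mu] g) (z : ℂ) : lap f z = lap g z := by
  refine integral_congr_ae ?_
  filter_upwards [h] with t ht
  rw [ht]

theorem lap_add {f g : ℝ → ℂ} (hf : Integrable f mu) (hg : Integrable g mu) (z : ℂ) :
    lap (fun t => f t + g t) z = lap f z + lap g z := by
  unfold lap
  rw [← integral_add (integrable_exp_mul hf z) (integrable_exp_mul hg z)]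
  simp only [mul_add]

theorem lap_sub {f g : ℝ → ℂ} (hf : Integrable f mu) (hg : Integrable g mu) (z : ℂ) :
    lap (fun t => f t - g t) z = lap f z - lap g z := by
  unfold lap
  rw [← integral_sub (integrable_exp_mul hf z) (integrable_exp_mul hg z)]
  simp only [mul_sub]

theorem lap_const_mul (c : ℂ) (f : ℝ → ℂ) (z : ℂ) :
    lap (fun t => c * f t) z = c * lap f z := by
  unfold lap
  rw [← integral_const_mul]
  congr 1
  ext t
  ring

theorem norm_lap_le {h : ℝ → ℂ} (hh : Integrable h mu) (z : ℂ) :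
    ‖lap h z‖ ≤ (∫ t, ‖h t‖ ∂mu) * growth z := by
  unfold lap
  refine (norm_integral_le_integral_norm _).trans ?_
  rw [← integral_mul_const]
  refine integral_mono_ae (integrable_exp_mul hh z).norm (hh.norm.mul_const _) ?_
  filter_upwards [norm_exp_le_growth_ae z] with t ht
  rw [norm_mul, mul_comm]
  gcongr

theorem Integrable.I_mul_id_mul {h : ℝ → ℂ} (hh : Integrable h mu) :
    Integrable (fun t : ℝ => Complex.I * t * h t) mu := by
  refine hh.bdd_mul (c := 2 * Real.pi)
    (by fun_prop : Continuous fun t : ℝ => Complex.I * (t : ℂ)).aestronglyMeasurable ?_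
  filter_upwards [ae_restrict_mem measurableSet_Ioo] with t ht
  rw [norm_mul, Complex.norm_I, one_mul, Complex.norm_real, Real.norm_of_nonneg ht.1.le]
  exact ht.2.le

theorem hasDerivAt_lap {h : ℝ → ℂ} (hh : Integrable h mu) (z : ℂ) :
    HasDerivAt (lap h) (lap (fun t => Complex.I * t * h t) z) z := by
  have hd := Integrable.I_mul_id_mul hh
  -- An upper bound for `growth` on the unit ball around `z`, where `|Im w| ≤ |Im z| + 1`.
  set C : ℝ := 1 + Real.exp (2 * Real.pi * (|z.im| + 1))
  refine (hasDerivAt_integral_of_dominated_loc_of_deriv_le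
    (F := fun (z : ℂ) (t : ℝ) => Complex.exp (Complex.I * z * t) * h t)
    (F' := fun (z : ℂ) (t : ℝ) => Complex.exp (Complex.I * z * t) * (Complex.I * t * h t))
    (bound := fun t => C * ‖Complex.I * t * h t‖)
    (Metric.ball_mem_nhds z one_pos) ?_ (integrable_exp_mul hh z)
    (integrable_exp_mul hd z).aestronglyMeasurable ?_ (hd.norm.const_mul _) ?_).2
  · exact Filter.Eventually.of_forall fun w => (integrable_exp_mul hh w).aestronglyMeasurable
  · filter_upwards [ae_restrict_mem measurableSet_Ioo] with t ht w hw
    rw [norm_mul]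
    gcongr
    refine (norm_exp_le_growth w (Ioo_subset_Icc_self ht)).trans ?_
    unfold growth C
    gcongr
    have h1 : |w.im - z.im| ≤ ‖w - z‖ := by simpa using Complex.abs_im_le_norm (w - z)
    have h2 : ‖w - z‖ < 1 := by simpa [dist_eq_norm] using hw
    have h3 : -w.im ≤ |z.im| + 1 := by
      have := neg_le_abs z.im
      have := neg_le_abs (w.im - z.im)
      linarith
    nlinarith [Real.pi_pos]
  · refine Filter.Eventually.of_forall fun t w _ => ?_
    have h1 : HasDerivAt (fun w : ℂ => Complex.I * w * t) (Complex.I * t) w := by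
      simpa using ((hasDerivAt_id w).const_mul Complex.I).mul_const (t : ℂ)
    exact (h1.cexp.mul_const (h t)).congr_deriv (by ring)

theorem differentiable_lap {h : ℝ → ℂ} (hh : Integrable h mu) : Differentiable ℂ (lap h) :=
  fun z => (hasDerivAt_lap hh z).differentiableAt

theorem hasDerivAt_exp_I_mul (z : ℂ) (t : ℝ) :
    HasDerivAt (fun t : ℝ => Complex.exp (Complex.I * z * t))
      (Complex.I * z * Complex.exp (Complex.I * z * t)) t := by
  have h1 : HasDerivAt (fun t : ℝ => Complex.I * z * (t : ℂ)) (Complex.I * z) t := by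
    simpa using (Complex.ofRealCLM.hasDerivAt (x := t)).const_mul (Complex.I * z)
  simpa [mul_comm] using h1.cexp

/-- One integration by parts gains a factor `1/‖z‖`; the boundary terms are also controlled by
`growth z`. -/
theorem norm_lap_le_of_hasDerivAt {f f' : ℝ → ℂ} (hf : ∀ t, HasDerivAt f (f' t) t)
    (hf' : Continuous f') {z : ℂ} (hz : z ≠ 0) :
    ‖lap f z‖ ≤ (‖f (2 * Real.pi)‖ + ‖f 0‖ + ∫ t, ‖f' t‖ ∂mu) / ‖z‖ * growth z := by
  have key : Complex.I * z * lap f z = f (2 * Real.pi) * Complex.exp (Complex.I * z * (2 * Real.pi : ℝ))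
      - f 0 * Complex.exp (Complex.I * z * (0 : ℝ)) - lap f' z := by
    have := intervalIntegral.integral_mul_deriv_eq_deriv_mul (a := 0) (b := 2 * Real.pi)
      (fun t _ => hf t) (fun t _ => hasDerivAt_exp_I_mul z t) (hf'.intervalIntegrable _ _)
      ((by fun_prop : Continuous fun t : ℝ =>
        Complex.I * z * Complex.exp (Complex.I * z * t)).intervalIntegrable _ _)
    rw [lap, lap, integral_mu_eq, integral_mu_eq, ← intervalIntegral.integral_const_mul]
    calc _ = ∫ t in (0 : ℝ)..2 * Real.pi, f t * (Complex.I * z * Complex.exp (Complex.I * z * t)) := by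
          congr 1; ext t; ring
      _ = _ := by
          rw [this]; congr 2; ext t; ring
  have hz' : 0 < ‖z‖ := norm_pos_iff.2 hz
  rw [div_mul_eq_mul_div, le_div_iff₀ hz']
  have h1 : ‖Complex.I * z * lap f z‖ = ‖lap f z‖ * ‖z‖ := by simp [mul_comm]
  rw [← h1, key]
  have e1 := norm_exp_le_growth z (t := 2 * Real.pi) ⟨by positivity, le_rfl⟩
  have e2 := norm_exp_le_growth z (t := 0) ⟨le_rfl, by positivity⟩
  refine (norm_sub_le _ _).trans ?_
  rw [add_mul]
  refine add_le_add ((norm_sub_le _ _).trans ?_) (norm_lap_le hf'.integrable_mu z)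
  rw [norm_mul, norm_mul, add_mul]
  gcongr

/-- The Riemann–Lebesgue lemma for the finite Laplace transform, uniformly in all directions. -/
theorem exists_norm_lap_le {h : ℝ → ℂ} (hh : Integrable h mu) {ε : ℝ} (hε : 0 < ε) :
    ∃ R : ℝ, 0 < R ∧ ∀ z : ℂ, R ≤ ‖z‖ → ‖lap h z‖ ≤ ε * growth z := by
  -- Density argument: `h` is approximated in `L¹` by a continuous `g`, and `g` by a polynomial `f`.
  -- Both errors and the decay of `lap f` are measured against `growth z`, which makes the bound
  -- uniform in the direction of `z`.
  obtain ⟨g, hg, hgi⟩ := hh.exists_boundedContinuous_integral_sub_le (by positivity : 0 < ε / 3)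
  -- Real and imaginary parts each contribute `ε/(12π)` on an interval of length `2π`, in total
  -- `ε/3`.
  have hδ : 0 < ε / (12 * Real.pi) := by positivity
  obtain ⟨p, hp⟩ := exists_polynomial_near_of_continuousOn 0 (2 * Real.pi) (fun t => (g t).re)
    (by fun_prop) _ hδ
  obtain ⟨q, hq⟩ := exists_polynomial_near_of_continuousOn 0 (2 * Real.pi) (fun t => (g t).im)
    (by fun_prop) _ hδ
  set f : ℝ → ℂ := fun t => ((p.eval t : ℝ) : ℂ) + Complex.I * ((q.eval t : ℝ) : ℂ)
  set f' : ℝ → ℂ := fun t => ((p.derivative.eval t : ℝ) : ℂ) + Complex.I * ((q.derivative.eval t : ℝ) : ℂ)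
  have hf : ∀ t, HasDerivAt f (f' t) t := fun t =>
    (p.hasDerivAt t).ofReal_comp.add ((q.hasDerivAt t).ofReal_comp.const_mul _)
  have hf' : Continuous f' := by unfold f'; fun_prop
  have hfc : Continuous f := by unfold f; fun_prop
  have hgf : ∫ t, ‖g t - f t‖ ∂mu ≤ ε / 3 := by
    have : ∀ᵐ t ∂mu, ‖g t - f t‖ ≤ ε / (6 * Real.pi) := by
      filter_upwards [ae_restrict_mem measurableSet_Ioo] with t ht
      have h1 := hp t (Ioo_subset_Icc_self ht)
      have h2 := hq t (Ioo_subset_Icc_self ht)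
      refine (Complex.norm_le_abs_re_add_abs_im _).trans ?_
      rw [show (g t - f t).re = -(p.eval t - (g t).re) by simp [f],
        show (g t - f t).im = -(q.eval t - (g t).im) by simp [f], abs_neg, abs_neg]
      have : ε / (6 * Real.pi) = ε / (12 * Real.pi) + ε / (12 * Real.pi) := by field_simp; norm_num
      linarith
    calc _ ≤ ∫ t, ε / (6 * Real.pi) ∂mu :=
          integral_mono_ae (hgi.sub hfc.integrable_mu).norm (integrable_const _) this
      _ = ε / 3 := by
          rw [integral_mu_eq, intervalIntegral.integral_const, sub_zero, smul_eq_mul]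
          field_simp; norm_num
  set M := ‖f (2 * Real.pi)‖ + ‖f 0‖ + ∫ t, ‖f' t‖ ∂mu
  have hM : 0 ≤ M := by
    have : 0 ≤ ∫ t, ‖f' t‖ ∂mu := integral_nonneg fun _ => norm_nonneg _
    positivity
  refine ⟨3 * M / ε + 1, by positivity, fun z hz => ?_⟩
  have hz0 : 0 < ‖z‖ := lt_of_lt_of_le (by positivity) hz
  have e1 := norm_lap_le_of_hasDerivAt hf hf' (norm_pos_iff.1 hz0)
  have e2 := norm_lap_le (hh.sub hgi) z
  have e3 := norm_lap_le (hgi.sub hfc.integrable_mu) z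
  have s1 : lap (h - ⇑g) z = lap h z - lap g z := lap_sub hh hgi z
  have s2 : lap (⇑g - f) z = lap g z - lap f z := lap_sub hgi hfc.integrable_mu z
  have hW := growth_pos z
  have e1' : ‖lap f z‖ ≤ ε / 3 * growth z := by
    refine e1.trans (mul_le_mul_of_nonneg_right ?_ hW.le)
    rw [div_le_iff₀ hz0]
    have : 3 * M / ε ≤ ‖z‖ := by linarith
    rw [div_le_iff₀ hε] at this
    linarith
  have e2' : ‖lap (h - ⇑g) z‖ ≤ ε / 3 * growth z :=
    e2.trans (mul_le_mul_of_nonneg_right hg hW.le)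
  have e3' : ‖lap (⇑g - f) z‖ ≤ ε / 3 * growth z :=
    e3.trans (mul_le_mul_of_nonneg_right hgf hW.le)
  have : lap h z = lap (h - ⇑g) z + lap (⇑g - f) z + lap f z := by rw [s1, s2]; ring
  rw [this]
  refine norm_add₃_le.trans ?_
  linarith

/-! ### Primitives of integrable functions and weak derivatives -/

/-- The primitive `x ↦ ∫₀ˣ h`. -/
def prim (h : ℝ → ℂ) (x : ℝ) : ℂ := ∫ t in (0 : ℝ)..x, h t

theorem prim_zero (h : ℝ → ℂ) : prim h 0 = 0 := intervalIntegral.integral_same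

theorem prim_two_pi (h : ℝ → ℂ) : prim h (2 * Real.pi) = ∫ t, h t ∂mu := (integral_mu_eq h).symm

theorem continuousOn_prim {h : ℝ → ℂ} (hh : Integrable h mu) :
    ContinuousOn (prim h) (Icc 0 (2 * Real.pi)) := by
  have := intervalIntegral.continuousOn_primitive_interval (μ := volume) (f := h) (a := 0)
    (b := 2 * Real.pi) ?_
  · rwa [uIcc_of_le (by positivity)] at this
  · rw [uIcc_of_le (by positivity), integrableOn_Icc_iff_integrableOn_Ioo]
    exact hh

theorem ContinuousOn.integrable_mu {E : Type*} [NormedAddCommGroup E] {f : ℝ → E}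
    (hf : ContinuousOn f (Icc 0 (2 * Real.pi))) : Integrable f mu :=
  (hf.integrableOn_Icc).mono_set Ioo_subset_Icc_self

theorem prim_eq_integral_indicator (h : ℝ → ℂ) {x : ℝ} (hx : x ∈ Ioo 0 (2 * Real.pi)) :
    prim h x = ∫ t, (Iic x).indicator h t ∂mu := by
  rw [integral_indicator measurableSet_Iic, Measure.restrict_restrict measurableSet_Iic, prim,
    intervalIntegral.integral_of_le hx.1.le]
  congr 2
  ext t
  simp only [mem_Ioc, mem_inter_iff, mem_Iic, mem_Ioo]
  constructor
  · rintro ⟨h1, h2⟩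
    exact ⟨h2, h1, h2.trans_lt hx.2⟩
  · rintro ⟨h1, h2, _⟩
    exact ⟨h2, h1⟩

/-- Integration by parts for a `C¹` function against the primitive of an integrable function. -/
theorem integral_deriv_mul_prim {u u' h : ℝ → ℂ} (hu : ∀ t, HasDerivAt u (u' t) t)
    (hu' : Continuous u') (hh : Integrable h mu) :
    ∫ x, u' x * prim h x ∂mu = u (2 * Real.pi) * prim h (2 * Real.pi) - ∫ t, u t * h t ∂mu := by
  have huc : Continuous u := continuous_iff_continuousAt.2 fun t => (hu t).continuousAt
  -- Fubini on the triangle `t ≤ x`: integrating `u'` over `x ∈ [t, 2π)` gives `u(2π) - u(t)`.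
  set k : ℝ → ℝ → ℂ := fun x t => {p : ℝ × ℝ | p.2 ≤ p.1}.indicator (fun p => u' p.1 * h p.2) (x, t)
  have hk : Integrable (Function.uncurry k) (mu.prod mu) :=
    (hu'.integrable_mu.mul_prod hh).indicator (measurableSet_le measurable_snd measurable_fst)
  have h1 : ∫ x, u' x * prim h x ∂mu = ∫ x, ∫ t, k x t ∂mu ∂mu := by
    refine integral_congr_ae ?_
    filter_upwards [ae_restrict_mem measurableSet_Ioo] with x hx
    rw [prim_eq_integral_indicator h hx, ← integral_const_mul]
    congr 1
    ext t
    by_cases htx : t ≤ x <;> simp [k, indicator, htx]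
  have h2 : ∀ᵐ t ∂mu, ∫ x, k x t ∂mu = (u (2 * Real.pi) - u t) * h t := by
    filter_upwards [ae_restrict_mem measurableSet_Ioo] with t ht
    have : ∀ x, k x t = (Ici t).indicator u' x * h t := by
      intro x
      by_cases htx : t ≤ x <;> simp [k, indicator, htx]
    simp only [this]
    rw [integral_mul_const, integral_indicator measurableSet_Ici,
      Measure.restrict_restrict measurableSet_Ici]
    have e : Ici t ∩ Ioo 0 (2 * Real.pi) = Ico t (2 * Real.pi) := by
      ext x
      simp only [mem_Ico, mem_inter_iff, mem_Ici, mem_Ioo]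
      constructor
      · rintro ⟨h1, _, h2⟩
        exact ⟨h1, h2⟩
      · rintro ⟨h1, h2⟩
        exact ⟨h1, ht.1.trans_le h1, h2⟩
    rw [e, integral_Ico_eq_integral_Ioc, ← intervalIntegral.integral_of_le ht.2.le,
      intervalIntegral.integral_eq_sub_of_hasDerivAt (fun x _ => hu x) (hu'.intervalIntegrable _ _)]
  have huh : Integrable (fun t => u t * h t) mu := by
    obtain ⟨C, hC⟩ := isCompact_Icc.exists_bound_of_continuousOn
      (huc.continuousOn (s := Icc 0 (2 * Real.pi)))
    refine hh.bdd_mul (c := C) huc.aestronglyMeasurable ?_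
    filter_upwards [ae_restrict_mem measurableSet_Ioo] with t ht
    exact hC t (Ioo_subset_Icc_self ht)
  rw [h1, integral_integral_swap hk, integral_congr_ae h2]
  simp only [sub_mul]
  rw [integral_sub (hh.const_mul _) huh, integral_const_mul, prim_two_pi]

theorem exists_Icc_superset_of_isCompact {s : Set ℝ} {a b : ℝ} (hs : IsCompact s)
    (hne : s.Nonempty) (hsub : s ⊆ Ioo a b) : ∃ c d, c ≤ d ∧ a < c ∧ d < b ∧ s ⊆ Icc c d := by
  obtain ⟨c, hc⟩ := hs.exists_isLeast hne
  obtain ⟨d, hd⟩ := hs.exists_isGreatest hne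
  exact ⟨c, d, hc.2 hd.1, (hsub hc.1).1, (hsub hd.1).2, fun x hx => ⟨hc.2 hx, hd.2 hx⟩⟩

/-- The primitive vanishes to the left of the support by construction, and to the right because the
total integral is zero. -/
theorem exists_test_primitive {ψ : ℝ → ℝ} (hψ : ContDiff ℝ (⊤ : ℕ∞) ψ) (hs : HasCompactSupport ψ)
    {a b : ℝ} (hab : a < b) (ht : tsupport ψ ⊆ Ioo a b) (h0 : ∫ x, ψ x = 0) :
    ∃ φ : ℝ → ℝ, ContDiff ℝ (⊤ : ℕ∞) φ ∧ HasCompactSupport φ ∧ tsupport φ ⊆ Ioo a b ∧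
      ∀ x, HasDerivAt φ (ψ x) x := by
  obtain ⟨c, d, hcd, hac, hdb, hsub⟩ : ∃ c d, c ≤ d ∧ a < c ∧ d < b ∧ tsupport ψ ⊆ Icc c d := by
    rcases (tsupport ψ).eq_empty_or_nonempty with h | h
    -- Empty support: any point of the open interval serves, here the midpoint.
    · exact ⟨(a + b) / 2, (a + b) / 2, le_rfl, by linarith, by linarith, by simp [h]⟩
    · exact exists_Icc_superset_of_isCompact hs h ht
  have hz : ∀ x, x ∉ Icc c d → ψ x = 0 := fun x hx =>
    image_eq_zero_of_notMem_tsupport fun h => hx (hsub h)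
  have hψc := hψ.continuous
  set φ : ℝ → ℝ := fun x => ∫ t in a..x, ψ t
  have hd : ∀ x, HasDerivAt φ (ψ x) x := fun x =>
    intervalIntegral.integral_hasDerivAt_right (hψc.intervalIntegrable _ _)
      (hψc.stronglyMeasurableAtFilter _ _) hψc.continuousAt
  have htot : ∫ t in c..d, ψ t = 0 := by
    rw [← h0, intervalIntegral.integral_of_le hcd, ← integral_Icc_eq_integral_Ioc]
    exact setIntegral_eq_integral_of_forall_compl_eq_zero hz
  have hleft : ∀ x ≤ c, φ x = 0 := by
    intro x hx
    have h1 : ∀ t ∈ Iio c, φ t = φ a := by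
      intro t ht'
      have : ∫ s in a..t, ψ s = 0 := by
        rw [intervalIntegral.integral_congr (g := fun _ => 0)]
        · simp
        · intro s hs'
          refine hz s fun hs'' => ?_
          have : s ≤ max a t := hs'.2
          have : max a t < c := max_lt hac ht'
          linarith [hs''.1]
      simp [φ, this]
    have ha : φ a = 0 := intervalIntegral.integral_same
    have hcont : Continuous φ := continuous_iff_continuousAt.2 fun x => (hd x).continuousAt
    rcases hx.lt_or_eq with h | h
    · rw [h1 x h, ha]
    · have : ∫ s in a..c, ψ s = ∫ s in a..c, (0 : ℝ) := by
        refine intervalIntegral.integral_congr_ae ?_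
        have : ∀ᵐ s : ℝ ∂volume, s ≠ c := by simp [ae_iff, measure_singleton]
        filter_upwards [this] with s hs' hs''
        refine hz s fun h3 => hs' (le_antisymm ?_ h3.1)
        rw [uIoc_of_le hac.le] at hs''
        exact hs''.2
      simpa [φ, h] using this
  have hright : ∀ x, d < x → φ x = 0 := by
    intro x hx
    have e1 : φ x = φ d + ∫ t in d..x, ψ t :=
      (intervalIntegral.integral_add_adjacent_intervals (hψc.intervalIntegrable _ _)
        (hψc.intervalIntegrable _ _)).symm
    have e2 : φ d = φ c + ∫ t in c..d, ψ t :=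
      (intervalIntegral.integral_add_adjacent_intervals (hψc.intervalIntegrable _ _)
        (hψc.intervalIntegrable _ _)).symm
    have e3 : ∫ t in d..x, ψ t = ∫ s in d..x, (0 : ℝ) := by
      refine intervalIntegral.integral_congr_ae (Filter.Eventually.of_forall fun s hs' => ?_)
      rw [uIoc_of_le hx.le] at hs'
      exact hz s fun h3 => absurd hs'.1 (not_lt.2 h3.2)
    rw [e1, e2, hleft c le_rfl, htot, e3]
    simp
  have hφs : tsupport φ ⊆ Icc c d := by
    refine closure_minimal (fun x hx => ?_) isClosed_Icc
    by_contra h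
    rw [mem_Icc, not_and_or, not_le, not_le] at h
    rcases h with h | h
    · exact hx (hleft x h.le)
    · exact hx (hright x h)
  refine ⟨φ, ?_, ?_, hφs.trans fun x hx => ⟨hac.trans_le hx.1, hx.2.trans_lt hdb⟩, hd⟩
  · rw [contDiff_infty_iff_deriv]
    refine ⟨fun x => (hd x).differentiableAt, ?_⟩
    rw [show deriv φ = ψ from funext fun x => (hd x).deriv]
    exact hψ
  · exact isCompact_Icc.of_isClosed_subset (isClosed_tsupport _) hφs

/-- Du Bois-Reymond: a continuous function whose integral against derivatives of test functions
vanishes is constant. -/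
theorem eq_const_of_integral_deriv_eq_zero {G : ℝ → ℂ}
    (hG : ContinuousOn G (Icc 0 (2 * Real.pi)))
    (h : ∀ φ : ℝ → ℝ, ContDiff ℝ (⊤ : ℕ∞) φ → HasCompactSupport φ →
      tsupport φ ⊆ Ioo 0 (2 * Real.pi) → ∫ x, deriv φ x • G x ∂mu = 0) :
    ∀ x ∈ Icc 0 (2 * Real.pi), G x = G 0 := by
  have hGi := hG.integrable_mu
  have hint : ∀ {φ : ℝ → ℝ}, Continuous φ → HasCompactSupport φ →
      Integrable (fun x => φ x • G x) mu := by
    intro φ hφ hs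
    obtain ⟨C, hC⟩ := hφ.bounded_above_of_compact_support hs
    exact hGi.bdd_smul C hφ.aestronglyMeasurable (Filter.Eventually.of_forall hC)
  have hpi := Real.pi_gt_three
  -- The outer ball `[π - 2, π + 2]` lies in `(0, 2π)` because `π > 3`.
  let B : ContDiffBump Real.pi := ⟨1, 2, one_pos, one_lt_two⟩
  set ρ : ℝ → ℝ := B.normed volume
  have hρ : ContDiff ℝ (⊤ : ℕ∞) ρ := B.contDiff_normed
  have hρs : HasCompactSupport ρ := B.hasCompactSupport_normed
  have hρt : tsupport ρ ⊆ Ioo 0 (2 * Real.pi) := by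
    rw [B.tsupport_normed_eq]
    intro x hx
    rw [Metric.mem_closedBall, Real.dist_eq, abs_le] at hx
    have : B.rOut = 2 := rfl
    constructor <;> linarith [hx.1, hx.2]
  have hρ1 : ∫ x, ρ x = 1 := B.integral_normed
  set C := ∫ x, ρ x • G x ∂mu
  have hmu : ∀ {ψ : ℝ → ℝ}, tsupport ψ ⊆ Ioo 0 (2 * Real.pi) → ∫ x, ψ x = ∫ x, ψ x ∂mu := by
    intro ψ hψ
    refine (setIntegral_eq_integral_of_forall_compl_eq_zero fun x hx => ?_).symm
    exact image_eq_zero_of_notMem_tsupport fun h => hx (hψ h)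
  have key : ∀ᵐ x ∂(volume : Measure ℝ), x ∈ Ioo 0 (2 * Real.pi) → G x - C = 0 := by
    apply isOpen_Ioo.ae_eq_zero_of_integral_contDiff_smul_eq_zero
    · have : IntegrableOn (fun x => G x - C) (Ioo 0 (2 * Real.pi)) volume :=
        hGi.sub (integrable_const C)
      exact this.locallyIntegrableOn
    · intro ψ hψ hs ht
      have e : ∫ x, ψ x • (G x - C) = ∫ x, ψ x • (G x - C) ∂mu := by
        refine (setIntegral_eq_integral_of_forall_compl_eq_zero fun x hx => ?_).symm
        rw [image_eq_zero_of_notMem_tsupport fun h => hx (ht h), zero_smul]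
      set m := ∫ x, ψ x
      have hts : tsupport (fun x => ψ x - m * ρ x) ⊆ Ioo 0 (2 * Real.pi) := by
        refine (tsupport_sub ψ fun x => m * ρ x).trans (union_subset ht ?_)
        exact (tsupport_mul_subset_right (f := fun _ => m) (g := ρ)).trans hρt
      -- Subtracting `m ρ` makes the mean zero, so `ψ - mρ` is the derivative of a test function;
      -- the hypothesis then gives `∫ ψ G = m C`.
      obtain ⟨φ, h1, h2, h3, h4⟩ := exists_test_primitive (ψ := fun x => ψ x - m * ρ x)
        (hψ.sub (contDiff_const.mul hρ)) (hs.sub (hρs.mul_left (f := fun _ => m)))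
        (by positivity) hts (by
          rw [integral_sub (hψ.continuous.integrable_of_hasCompactSupport hs)
            ((hρ.continuous.integrable_of_hasCompactSupport hρs).const_mul m),
            integral_const_mul, hρ1, mul_one, sub_self])
      have h5 := h φ h1 h2 h3
      have h6 : ∫ x, deriv φ x • G x ∂mu = ∫ x, ψ x • G x ∂mu - m * C := by
        rw [← integral_const_mul, ← integral_sub (hint hψ.continuous hs)
          ((hint hρ.continuous hρs).const_mul _)]
        congr 1
        ext x
        rw [(h4 x).deriv, sub_smul, mul_smul]
        simp
      rw [e]
      simp_rw [smul_sub]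
      rw [integral_sub (hint hψ.continuous hs)
        ((hψ.continuous.integrable_mu).smul_const C), integral_smul_const, ← hmu ht]
      rw [h6] at h5
      simpa [m] using h5
  rw [← ae_restrict_iff' measurableSet_Ioo] at key
  have heq : EqOn G (fun _ => C) (Icc 0 (2 * Real.pi)) := by
    refine Measure.eqOn_Icc_of_ae_eq volume (by positivity) ?_ hG continuousOn_const
    rw [← restrict_Ioo_eq_restrict_Icc]
    filter_upwards [key] with x hx
    exact sub_eq_zero.mp hx
  intro x hx
  rw [heq hx, heq ⟨le_rfl, by positivity⟩]

theorem hasDerivAt_ofReal_test {φ : ℝ → ℝ} (hφ : ContDiff ℝ (⊤ : ℕ∞) φ) (t : ℝ) :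
    HasDerivAt (fun t => (φ t : ℂ)) ((deriv φ t : ℝ) : ℂ) t :=
  ((hφ.differentiable (by simp)) t).hasDerivAt.ofReal_comp

theorem test_two_pi {φ : ℝ → ℝ} (ht : tsupport φ ⊆ Ioo 0 (2 * Real.pi)) : φ (2 * Real.pi) = 0 :=
  image_eq_zero_of_notMem_tsupport fun h => absurd (ht h).2 (lt_irrefl _)

/-- A continuous representative is a primitive of the weak derivative. -/
theorem HasWeakDeriv.eq_prim {f g : L2} (hw : HasWeakDeriv f g) {F : ℝ → ℂ} (hF : IsContRep f F)
    {x : ℝ} (hx : x ∈ Icc 0 (2 * Real.pi)) : F x = F 0 + prim g x := by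
  have hp := continuousOn_prim g.integrable
  -- `F - prim g` has weak derivative zero.
  have := eq_const_of_integral_deriv_eq_zero (G := fun x => F x - prim g x) (hF.1.sub hp) ?_ x hx
  · rw [prim_zero, sub_zero] at this
    rw [← this]; ring
  · intro φ hφ hs ht
    have hd : Continuous (deriv φ) := hφ.continuous_deriv (by simp)
    have h1 := integral_deriv_mul_prim (fun t => hasDerivAt_ofReal_test hφ t)
      (Complex.continuous_ofReal.comp hd) g.integrable
    rw [test_two_pi ht, Complex.ofReal_zero, zero_mul, zero_sub] at h1
    have h2 : ∫ x, deriv φ x • F x ∂mu = ∫ x, deriv φ x • f x ∂mu := by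
      refine integral_congr_ae ?_
      filter_upwards [hF.2] with x hx
      rw [hx]
    have h3 := hw φ hφ hs ht
    simp_rw [smul_sub]
    have hb : ∀ {H : ℝ → ℂ}, Integrable H mu → Integrable (fun x => deriv φ x • H x) mu := by
      intro H hH
      obtain ⟨C, hC⟩ := hd.bounded_above_of_compact_support hs.deriv
      exact hH.bdd_smul C hd.aestronglyMeasurable (Filter.Eventually.of_forall hC)
    rw [integral_sub (hb hF.1.integrable_mu) (hb hp.integrable_mu), h2, h3]
    simp only [Complex.real_smul]
    rw [h1, sub_self]

/-! ### The characteristic function of `P1 K` and the resolvent equation -/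

/-- The characteristic function `z ↦ e^{2πiz} - 1 - i ∫₀^{2π} e^{izt} K(t) dt`. -/
def charFn (K : ℝ → ℂ) (z : ℂ) : ℂ :=
  Complex.exp (2 * Real.pi * Complex.I * z) - 1 - Complex.I * lap K z

/-- The Laplace transform at `z` as a linear functional on `L²`. -/
def lapLin (z : ℂ) : L2 →ₗ[ℂ] ℂ where
  toFun f := lap f z
  map_add' f g := by
    rw [lap_congr (Lp.coeFn_add f g)]
    exact lap_add f.integrable g.integrable z
  map_smul' c f := by
    rw [lap_congr (Lp.coeFn_smul c f)]
    exact lap_const_mul c f z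

theorem lapLin_apply (z : ℂ) (f : L2) : lapLin z f = lap f z := rfl

/-- Integration by parts for the Laplace transform of a weak derivative. -/
theorem lap_weakDeriv {f g : L2} (hw : HasWeakDeriv f g) {F : ℝ → ℂ} (hF : IsContRep f F) (z : ℂ) :
    lap g z = Complex.exp (2 * Real.pi * Complex.I * z) * F (2 * Real.pi) - F 0
      - Complex.I * z * lap f z := by
  have hd : Continuous fun t : ℝ => Complex.I * z * Complex.exp (Complex.I * z * t) := by fun_prop
  have h1 := integral_deriv_mul_prim (hasDerivAt_exp_I_mul z) hd g.integrable
  have h2 : ∫ x, Complex.I * z * Complex.exp (Complex.I * z * x) * prim g x ∂mu =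
      Complex.I * z * lap f z - (Complex.exp (2 * Real.pi * Complex.I * z) - 1) * F 0 := by
    have e1 : ∫ x : ℝ, Complex.I * z * Complex.exp (Complex.I * z * x) ∂mu =
        Complex.exp (2 * Real.pi * Complex.I * z) - 1 := by
      rw [integral_mu_eq, intervalIntegral.integral_eq_sub_of_hasDerivAt
        (fun x _ => hasDerivAt_exp_I_mul z x) (hd.intervalIntegrable _ _)]
      congr 2
      · push_cast; ring
      · simp
    rw [← e1, lap, ← integral_const_mul, ← integral_mul_const, ← integral_sub
      ((integrable_exp_mul f.integrable z).const_mul _) (hd.integrable_mu.mul_const _)]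
    refine integral_congr_ae ?_
    filter_upwards [hF.2, ae_restrict_mem measurableSet_Ioo] with x hx hx'
    rw [hx, hw.eq_prim hF (Ioo_subset_Icc_self hx')]
    ring
  have h3 := hw.eq_prim hF (x := 2 * Real.pi) ⟨by positivity, le_rfl⟩
  have h4 : Complex.exp (Complex.I * z * ((2 * Real.pi : ℝ) : ℂ)) =
      Complex.exp (2 * Real.pi * Complex.I * z) := by
    congr 1; push_cast; ring
  rw [h2, h4] at h1
  change _ = _ - lap g z at h1
  rw [h3]
  linear_combination h1

theorem exists_isContRep_endValue (f : domP) :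
    ∃ F : ℝ → ℂ, IsContRep f F ∧ F 0 = endValue f ∧ F (2 * Real.pi) = endValue f :=
  ⟨f.2.2.choose, f.2.2.choose_spec.1, f.2.2.choose_spec.2, rfl⟩

/-- Equal boundary values `c` turn the boundary term into `c(e^{2πiz} - 1)`; together with `c lap K
z` it makes up `i c D(z)`. All spectral information is drawn from this identity. -/
theorem lap_P1 (K : L2) (f : (P1 K).domain) (z : ℂ) :
    lap (P1 K f) z = z * lap (f : L2) z + Complex.I * endValue f * charFn K z := by
  obtain ⟨F, hF, h0, h1⟩ := exists_isContRep_endValue f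
  have e : P1 K f = Complex.I • weakDeriv f + endValue f • K := rfl
  have h2 := lap_weakDeriv (weakDeriv_spec f) hF z
  rw [h0, h1] at h2
  rw [← lapLin_apply, e, map_add, map_smul, map_smul, lapLin_apply, lapLin_apply, h2, charFn,
    smul_eq_mul, smul_eq_mul]
  linear_combination (endValue f * lap K z - z * lap (f : L2) z)
    * Complex.I_mul_I

theorem lap_P1_sub (K : L2) (f : (P1 K).domain) (lam z : ℂ) :
    lap (P1 K f - lam • (f : L2) : L2) z =
      (z - lam) * lap (f : L2) z + Complex.I * endValue f * charFn K z := by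
  rw [← lapLin_apply, map_sub, map_smul, lapLin_apply, lapLin_apply, lap_P1, smul_eq_mul]
  ring

theorem memLp_of_continuousOn {F : ℝ → ℂ} (hF : ContinuousOn F (Icc 0 (2 * Real.pi))) :
    MemLp F 2 mu := by
  obtain ⟨C, hC⟩ := isCompact_Icc.exists_bound_of_continuousOn hF
  refine MemLp.of_bound hF.integrable_mu.aestronglyMeasurable C ?_
  filter_upwards [ae_restrict_mem measurableSet_Ioo] with t ht
  exact hC t (Ioo_subset_Icc_self ht)

/-- The product rule for `E (c + prim h)`, `E` the exponential, in weak form: `φ E` plays the role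
of the smooth factor in the integration by parts against `prim h`. -/
theorem hasWeakDeriv_exp_mul_prim (lam c : ℂ) {h : ℝ → ℂ} (hh : Integrable h mu) {f g : L2}
    (hf : f =ᵐ[mu] fun x : ℝ => Complex.exp (Complex.I * (-lam) * x) * (c + prim h x))
    (hg : g =ᵐ[mu] fun x : ℝ => Complex.exp (Complex.I * (-lam) * x) * h x
      - Complex.I * lam * f x) : HasWeakDeriv f g := by
  intro φ hφ hs ht
  have hd : Continuous (deriv φ) := hφ.continuous_deriv (by simp)
  set E : ℝ → ℂ := fun x => Complex.exp (Complex.I * (-lam) * x)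
  have hE : Continuous E := continuous_exp_I_mul _
  have hφc : Continuous fun x => (φ x : ℂ) := Complex.continuous_ofReal.comp hφ.continuous
  have hdc : Continuous fun x => ((deriv φ x : ℝ) : ℂ) := Complex.continuous_ofReal.comp hd
  set u' : ℝ → ℂ := fun x => ((deriv φ x : ℝ) : ℂ) * E x + φ x * (Complex.I * (-lam) * E x)
  have hu' : Continuous u' := by fun_prop
  have hu : ∀ t, HasDerivAt (fun x => (φ x : ℂ) * E x) (u' t) t := fun t =>
    (hasDerivAt_ofReal_test hφ t).mul (hasDerivAt_exp_I_mul _ t)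
  have h0 : φ 0 = 0 :=
    image_eq_zero_of_notMem_tsupport fun h => absurd (ht h).1 (lt_irrefl _)
  have h1 := integral_deriv_mul_prim hu hu' hh
  have h2 : ∫ x, u' x ∂mu = 0 := by
    rw [integral_mu_eq, intervalIntegral.integral_eq_sub_of_hasDerivAt
        (fun x _ => hu x) (hu'.intervalIntegrable _ _), test_two_pi ht, h0]
    simp
  rw [test_two_pi ht, Complex.ofReal_zero, zero_mul, zero_mul, zero_sub] at h1
  rw [eq_neg_iff_add_eq_zero, ← integral_add (f.integrable_smul hd hs.deriv)
    (g.integrable_smul hφ.continuous hs)]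
  have hEh : Integrable (fun t => (φ t : ℂ) * E t * h t) mu := by
    have h3 : Continuous fun t => (φ t : ℂ) * E t := by fun_prop
    obtain ⟨C, hC⟩ := h3.bounded_above_of_compact_support
      ((hs.comp_left Complex.ofReal_zero).mul_right (f' := E))
    exact hh.bdd_mul h3.aestronglyMeasurable (Filter.Eventually.of_forall hC)
  have hup : Integrable (fun x => u' x * prim h x) mu :=
    (hu'.continuousOn.mul (continuousOn_prim hh)).integrable_mu
  calc _ = ∫ x, (c * u' x + u' x * prim h x) + (φ x : ℂ) * E x * h x ∂mu := by
        refine integral_congr_ae ?_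
        filter_upwards [hf, hg] with x hx hx'
        rw [hx', hx, Complex.real_smul, Complex.real_smul]
        simp only [u', E]
        ring
    _ = 0 := by
        have h4 := (hu'.integrable_mu).const_mul c
        have h5 := integral_add (h4.add hup) hEh
        simp only [Pi.add_apply] at h5
        rw [h5, integral_add h4 hup, integral_const_mul, h2, h1]
        ring

/-- Solvability of `(P1 K - lam) f = g` with prescribed boundary value. -/
theorem exists_P1_sub_eq (K g : L2) {lam c : ℂ} (h : lap g lam = Complex.I * c * charFn K lam) :
    ∃ f : (P1 K).domain, P1 K f - lam • (f : L2) = g ∧ endValue f = c := by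
  -- With `f(2π) = c` the equation reads `f' + iλf = i(cK - g)`; it is solved with the integrating
  -- factor `e^{iλx}`.
  set k : L2 := Complex.I • (c • K - g)
  set H : ℝ → ℂ := fun t : ℝ => Complex.exp (Complex.I * lam * t) * k t
  have hH : Integrable H mu := integrable_exp_mul k.integrable lam
  set F : ℝ → ℂ := fun x : ℝ => Complex.exp (Complex.I * (-lam) * x) * (c + prim H x)
  have hF : ContinuousOn F (Icc 0 (2 * Real.pi)) :=
    (continuous_exp_I_mul _).continuousOn.mul (continuousOn_const.add (continuousOn_prim hH))
  have hFm := memLp_of_continuousOn hF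
  set f : L2 := hFm.toLp F
  have hfF : f =ᵐ[mu] F := hFm.coeFn_toLp
  set f' : L2 := k - (Complex.I * lam) • f
  have hw : HasWeakDeriv f f' := by
    refine hasWeakDeriv_exp_mul_prim lam c hH hfF ?_
    filter_upwards [Lp.coeFn_sub k ((Complex.I * lam) • f), Lp.coeFn_smul (Complex.I * lam) f]
      with x h1 h2
    rw [h1, Pi.sub_apply, h2, Pi.smul_apply, smul_eq_mul, ← mul_assoc, ← Complex.exp_add]
    simp
  have hrep : IsContRep f F := ⟨hF, hfF⟩
  have hF0 : F 0 = c := by simp [F, prim_zero]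
  -- The hypothesis on `lap g lam` is exactly the condition that this solution of the initial value
  -- problem be periodic.
  have hF1 : F (2 * Real.pi) = c := by
    have h1 : prim H (2 * Real.pi) = Complex.I * (c * lap K lam - lap g lam) := by
      rw [prim_two_pi]
      change lap k lam = _
      rw [← lapLin_apply, map_smul, map_sub, map_smul]
      rfl
    have h2 : c + prim H (2 * Real.pi) = c * Complex.exp (2 * Real.pi * Complex.I * lam) := by
      rw [h1, h, charFn]
      linear_combination (c * (1 - Complex.exp (2 * Real.pi * Complex.I * lam))
        + c * Complex.I * lap K lam) * Complex.I_mul_I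
    have h3 : Complex.exp (Complex.I * (-lam) * ((2 * Real.pi : ℝ) : ℂ)) *
        Complex.exp (2 * Real.pi * Complex.I * lam) = 1 := by
      rw [← Complex.exp_add, ← Complex.exp_zero]
      congr 1
      push_cast
      ring
    simp only [F]
    rw [h2]
    linear_combination c * h3
  have hdom : f ∈ (P1 K).domain := ⟨⟨f', hw⟩, F, hrep, hF0.trans hF1.symm⟩
  have hend : endValue ⟨f, hdom⟩ = c := (endValue_eq ⟨f, hdom⟩ hrep).trans hF1
  have hder : weakDeriv ⟨f, hdom⟩ = f' := (weakDeriv_spec ⟨f, hdom⟩).unique hw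
  refine ⟨⟨f, hdom⟩, ?_, hend⟩
  change Complex.I • weakDeriv ⟨f, hdom⟩ + endValue ⟨f, hdom⟩ • K - lam • f = g
  rw [hend, hder]
  simp only [f', k, smul_sub, smul_smul, ← mul_assoc, Complex.I_mul_I]
  module

/-- The Laplace transform is injective: its values at the integers are Fourier coefficients. -/
theorem L2.eq_zero_of_lap_intCast_eq_zero {f : L2} (h : ∀ n : ℤ, lap f n = 0) : f = 0 := by
  have hpos : (0 : ℝ) < 2 * Real.pi := by positivity
  have hm : MemLp f 2 (volume.restrict (Ioc 0 (2 * Real.pi))) := by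
    rw [← restrict_Ioo_eq_restrict_Ioc]
    exact Lp.memLp f
  -- Parseval: all Fourier coefficients vanish, hence so does the norm.
  have h1 := tsum_sq_fourierCoeffOn hpos hm
  have h2 : ∀ n : ℤ, fourierCoeffOn hpos f n = 0 := by
    intro n
    rw [fourierCoeffOn_eq_integral]
    have : ∫ x in (0 : ℝ)..2 * Real.pi, (fourier (-n)) (x : AddCircle (2 * Real.pi - 0)) • f x =
        lap f ((-n : ℤ) : ℂ) := by
      rw [lap, integral_mu_eq]
      congr 1
      ext x
      rw [fourier_coe_apply, smul_eq_mul]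
      congr 2
      have : (Real.pi : ℂ) ≠ 0 := by exact_mod_cast Real.pi_ne_zero
      push_cast
      field_simp
      ring
    rw [this, h, smul_zero]
  simp only [h2, norm_zero, ne_eq, OfNat.ofNat_ne_zero, not_false_eq_true, zero_pow, tsum_zero,
    sub_zero, smul_eq_mul] at h1
  have h3 : ∫ x, ‖f x‖ ^ 2 ∂mu = 0 := by
    rw [integral_mu_eq]
    rcases mul_eq_zero.1 h1.symm with h | h
    · exact absurd h (by positivity)
    · exact h
  have hi : Integrable (fun x => ‖f x‖ ^ 2) mu := (Lp.memLp f).integrable_norm_pow (by norm_num)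
  rw [integral_eq_zero_iff_of_nonneg (fun x => by positivity) hi] at h3
  apply Lp.ext
  filter_upwards [h3, Lp.coeFn_zero ℂ 2 mu] with x hx hx'
  rw [hx']
  simpa using hx

/-- Without boundary value the transform identity is `(z - λ) lap f z = 0`, so `lap f` vanishes off
`λ`, and at `λ` by continuity. Hence an eigenspace is at most a line. -/
theorem eq_zero_of_P1_eq_smul {K : L2} {lam : ℂ} {f : (P1 K).domain}
    (h : P1 K f = lam • (f : L2)) (h0 : endValue f = 0) : f = 0 := by
  have h1 : ∀ z, (z - lam) * lap (f : L2) z = 0 := by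
    intro z
    have h2 := lap_P1_sub K f lam z
    rw [h, h0, sub_self, ← lapLin_apply, map_zero] at h2
    simpa using h2.symm
  have h3 : lap (f : L2) = 0 := by
    refine Continuous.ext_on (dense_compl_singleton lam)
      (differentiable_lap (f : L2).integrable).continuous continuous_const fun z hz => ?_
    exact (mul_eq_zero.1 (h1 z)).resolve_left (sub_ne_zero.2 hz)
  exact Subtype.ext (L2.eq_zero_of_lap_intCast_eq_zero fun n => by rw [h3]; rfl)

/-! ### The algebraic multiplicity is the order of vanishing of the characteristic function -/

section JordanChain

variable {H : Type*} [AddCommGroup H] [Module ℂ H] {A : H →ₗ.[ℂ] H} {lam : ℂ}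

/-- `A - lam` as a linear map on the domain of `A`. -/
def shifted (A : H →ₗ.[ℂ] H) (lam : ℂ) : A.domain →ₗ[ℂ] H :=
  A.toFun - lam • A.domain.subtype

theorem shifted_apply (f : A.domain) : shifted A lam f = A f - lam • (f : H) := rfl

theorem mem_kerPow_succ {k : ℕ} {f : H} :
    f ∈ kerPow A lam (k + 1) ↔ ∃ hf : f ∈ A.domain, shifted A lam ⟨f, hf⟩ ∈ kerPow A lam k :=
  Iff.rfl

variable {c : A.domain →ₗ[ℂ] ℂ} {E : ℕ → A.domain} {n : ℕ}

/-- Applying `c` isolates the coefficient of `E 0`; applying `A - lam` then lowers every index by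
one, and induction takes over. -/
theorem linearIndependent_of_chain (hc0 : c (E 0) = 1) (hc : ∀ j < n, c (E (j + 1)) = 0)
    (h0 : shifted A lam (E 0) = 0) (hs : ∀ j < n, shifted A lam (E (j + 1)) = E j)
    (k : ℕ) (hk : k ≤ n + 1) (a : ℕ → ℂ) (ha : ∑ j ∈ Finset.range k, a j • E j = 0) :
    ∀ j < k, a j = 0 := by
  induction k generalizing a with
  | zero => intro j hj; omega
  | succ k ih =>
    have e : ∀ j ∈ Finset.range k, j < n := fun j hj => by
      have := Finset.mem_range.1 hj; omega
    rw [Finset.sum_range_succ'] at ha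
    have h1 : a 0 = 0 := by
      have := congrArg c ha
      rw [map_add, map_sum, Finset.sum_eq_zero, map_smul, hc0, map_zero] at this
      · simpa using this
      · intro j hj
        rw [map_smul, hc j (e j hj), smul_zero]
    have h2 : ∑ j ∈ Finset.range k, a (j + 1) • E j = 0 := by
      have := congrArg (shifted A lam) ha
      rw [map_add, map_sum, map_smul, h0, smul_zero, add_zero, map_zero] at this
      apply Subtype.ext
      rw [Submodule.coe_zero, ← this, AddSubmonoidClass.coe_finsetSum]
      refine Finset.sum_congr rfl fun j hj => ?_
      rw [map_smul, hs j (e j hj), Submodule.coe_smul]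
    intro j hj
    rcases j with _ | j
    · exact h1
    · exact ih (by omega) (fun j => a (j + 1)) h2 j (by omega)

theorem mem_kerPow_of_chain (h0 : shifted A lam (E 0) = 0)
    (hs : ∀ j < n, shifted A lam (E (j + 1)) = E j) (j : ℕ) (hj : j ≤ n) :
    (E j : H) ∈ kerPow A lam (j + 1) := by
  induction j with
  | zero =>
    refine mem_kerPow_succ.2 ⟨(E 0).2, ?_⟩
    rw [Subtype.coe_eta, h0]
    exact zero_mem _
  | succ j ih =>
    refine mem_kerPow_succ.2 ⟨(E (j + 1)).2, ?_⟩
    rw [Subtype.coe_eta, hs j (by omega)]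
    exact ih (by omega)

/-- `L` kills the range of `A - lam` but not `E n`, so the chain cannot be prolonged; since the
kernel is a line, nothing else occurs in the root space. -/
theorem exists_sum_chain_of_mem_kerPow (hker : ∀ f, shifted A lam f = 0 → c f = 0 → f = 0)
    (hc0 : c (E 0) = 1) (hc : ∀ j < n, c (E (j + 1)) = 0)
    (h0 : shifted A lam (E 0) = 0) (hs : ∀ j < n, shifted A lam (E (j + 1)) = E j)
    (L : H →ₗ[ℂ] ℂ) (hL : ∀ f, L (shifted A lam f) = 0) (hLn : L (E n) ≠ 0) (k : ℕ) (f : H)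
    (hf : f ∈ kerPow A lam k) :
    ∃ a : ℕ → ℂ, f = ∑ j ∈ Finset.range (n + 1), a j • (E j : H) := by
  induction k generalizing f with
  | zero => exact ⟨0, by simpa using (Submodule.mem_bot ℂ).1 hf⟩
  | succ k ih =>
    obtain ⟨hd, hf'⟩ := mem_kerPow_succ.1 hf
    obtain ⟨a, ha⟩ := ih _ hf'
    have hlt : ∀ j ∈ Finset.range n, j < n := fun j hj => Finset.mem_range.1 hj
    rw [Finset.sum_range_succ] at ha
    have e1 : shifted A lam (∑ j ∈ Finset.range n, a j • E (j + 1)) =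
        ∑ j ∈ Finset.range n, a j • (E j : H) := by
      rw [map_sum]
      exact Finset.sum_congr rfl fun j hj => by rw [map_smul, hs j (hlt j hj)]
    rw [← e1] at ha
    -- Everything in the expansion except the `E n` term lies in the range of `A - lam`, so `L`
    -- detects the coefficient `a n`.
    have han : a n = 0 := by
      have := hL ⟨f, hd⟩
      rw [ha, map_add, hL, zero_add, map_smul, smul_eq_mul] at this
      exact (mul_eq_zero.1 this).resolve_right hLn
    rw [han, zero_smul, add_zero] at ha
    -- After subtraction of the preimage and of the right multiple of `E 0`, the rest is in the
    -- kernel and has `c = 0`.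
    have key := hker (⟨f, hd⟩ - ∑ j ∈ Finset.range n, a j • E (j + 1) - c ⟨f, hd⟩ • E 0)
      (by rw [map_sub, map_sub, ha, sub_self, map_smul, h0, smul_zero, sub_zero])
      (by
        rw [map_sub, map_sub, map_smul, hc0, map_sum, Finset.sum_eq_zero]
        · simp
        · intro j hj
          rw [map_smul, hc j (hlt j hj), smul_zero])
    refine ⟨fun j => if j = 0 then c ⟨f, hd⟩ else a (j - 1), ?_⟩
    rw [Finset.sum_range_succ']
    have := congrArg (fun x : A.domain => (x : H)) key
    simp only [Submodule.coe_sub, AddSubmonoidClass.coe_finsetSum, Submodule.coe_smul,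
      Submodule.coe_zero] at this
    rw [sub_sub, sub_eq_zero] at this
    simpa using this

/-- The hypotheses describe a single Jordan block of size `n + 1`. -/
theorem algMult_eq_of_chain (hker : ∀ f, shifted A lam f = 0 → c f = 0 → f = 0)
    (hc0 : c (E 0) = 1) (hc : ∀ j < n, c (E (j + 1)) = 0)
    (h0 : shifted A lam (E 0) = 0) (hs : ∀ j < n, shifted A lam (E (j + 1)) = E j)
    (L : H →ₗ[ℂ] ℂ) (hL : ∀ f, L (shifted A lam f) = 0) (hLn : L (E n) ≠ 0) :
    algMult A lam = ((n + 1 : ℕ) : Cardinal) := by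
  set v : Fin (n + 1) → H := fun j => (E j : H)
  have hli : LinearIndependent ℂ v := by
    rw [Fintype.linearIndependent_iff]
    intro g hg i
    set a : ℕ → ℂ := fun j => if h : j < n + 1 then g ⟨j, h⟩ else 0
    have hga : ∀ i : Fin (n + 1), g i = a i := fun i => by simp only [a, i.2, dif_pos]
    rw [hga]
    refine linearIndependent_of_chain hc0 hc h0 hs (n + 1) le_rfl a ?_ i i.2
    apply Subtype.ext
    rw [Submodule.coe_zero, ← hg, AddSubmonoidClass.coe_finsetSum, Finset.sum_range]
    exact Finset.sum_congr rfl fun j _ => by rw [hga]; rfl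
  have hspan : rootSpace A lam = Submodule.span ℂ (range v) := by
    apply le_antisymm
    · rintro f ⟨k, hk⟩
      obtain ⟨a, rfl⟩ := exists_sum_chain_of_mem_kerPow hker hc0 hc h0 hs L hL hLn k f hk
      refine Submodule.sum_mem _ fun j hj => Submodule.smul_mem _ _ (Submodule.subset_span ?_)
      exact ⟨⟨j, Finset.mem_range.1 hj⟩, rfl⟩
    · rw [Submodule.span_le]
      rintro _ ⟨j, rfl⟩
      exact ⟨_, mem_kerPow_of_chain h0 hs j (by omega)⟩
  rw [algMult, hspan, rank_eq_card_basis (Module.Basis.span hli), Fintype.card_fin]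

end JordanChain

/-- The boundary value as a linear functional on the domain of `P1 K`. -/
def endLin (K : L2) : (P1 K).domain →ₗ[ℂ] ℂ where
  toFun f := endValue f
  map_add' f g := endValue_eq (f + g) (f.2.2.choose_spec.1.add g.2.2.choose_spec.1)
  map_smul' c f := endValue_eq (c • f) (f.2.2.choose_spec.1.smul c)

theorem endLin_apply (K : L2) (f : (P1 K).domain) : endLin K f = endValue f := rfl

/-- At `z = λ` the transform identity for an eigenvector reduces to `i c D(λ) = 0` with `c ≠ 0`;
conversely one solves with `g = 0`, `c = 1`. -/
theorem isEigenvalue_P1_iff (K : L2) (lam : ℂ) : IsEigenvalue (P1 K) lam ↔ charFn K lam = 0 := by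
  constructor
  · rintro ⟨f, hf, h⟩
    have h1 := lap_P1_sub K f lam lam
    rw [h, sub_self, sub_self, zero_mul, zero_add, ← lapLin_apply, map_zero] at h1
    have h2 : endValue f ≠ 0 := fun h3 => hf (eq_zero_of_P1_eq_smul h h3)
    simpa [h2] using h1.symm
  · intro h
    obtain ⟨f, hf, hc⟩ := exists_P1_sub_eq K 0 (lam := lam) (c := 1)
      (by rw [h, mul_zero, ← lapLin_apply, map_zero])
    refine ⟨f, ?_, sub_eq_zero.1 hf⟩
    rintro rfl
    rw [← endLin_apply, map_zero] at hc
    exact zero_ne_one hc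

/-- `F` is the continuous extension of `a D/(z - λ)^k`, whose order at `λ` is `m - k`. -/
theorem apply_eq_zero_iff_of_pow_mul_eq {F D : ℂ → ℂ} {lam : ℂ} {m k : ℕ} (hk : k ≤ m)
    (hF : ContinuousAt F lam) (hD : AnalyticAt ℂ D lam) (hm : analyticOrderAt D lam = m)
    {a : ℂ} (ha : a ≠ 0) (h : ∀ z, (z - lam) ^ k * F z = a * D z) : F lam = 0 ↔ k < m := by
  obtain ⟨g, hg, hg0, hgD⟩ := (hD.analyticOrderAt_eq_natCast).1 hm
  have h1 : ∀ᶠ z in nhdsWithin lam {lam}ᶜ, F z = a * ((z - lam) ^ (m - k) * g z) := by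
    filter_upwards [hgD.filter_mono nhdsWithin_le_nhds, self_mem_nhdsWithin] with z hz hz'
    have h2 : (z - lam) ^ k ≠ 0 := pow_ne_zero _ (sub_ne_zero.2 hz')
    apply mul_left_cancel₀ h2
    have h3 : (z - lam) ^ m = (z - lam) ^ k * (z - lam) ^ (m - k) := by
      rw [← pow_add]; congr 1; omega
    rw [h, hz, smul_eq_mul, h3]
    ring
  have h2 : Filter.Tendsto F (nhdsWithin lam {lam}ᶜ) (nhds (a * ((lam - lam) ^ (m - k) * g lam))) := by
    refine Filter.Tendsto.congr' (h1.mono fun z hz => hz.symm) ?_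
    have : ContinuousAt (fun z => a * ((z - lam) ^ (m - k) * g z)) lam := by
      have := hg.continuousAt
      fun_prop
    exact this.tendsto.mono_left nhdsWithin_le_nhds
  have h3 := tendsto_nhds_unique (hF.tendsto.mono_left nhdsWithin_le_nhds) h2
  rw [h3, sub_self]
  rcases hk.lt_or_eq with h4 | h4
  · simp [h4, Nat.sub_ne_zero_of_lt h4]
  · simp [h4, ha, hg0]

theorem differentiable_charFn {K : ℝ → ℂ} (hK : Integrable K mu) : Differentiable ℂ (charFn K) := by
  have := differentiable_lap hK
  unfold charFn
  fun_prop

theorem analyticAt_charFn {K : ℝ → ℂ} (hK : Integrable K mu) (z : ℂ) :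
    AnalyticAt ℂ (charFn K) z :=
  (differentiable_charFn hK).analyticAt z

/-- The algebraic multiplicity of an eigenvalue is the order of vanishing of the characteristic
function. -/
theorem algMult_P1 (K : L2) {lam : ℂ} {n : ℕ}
    (hn : analyticOrderAt (charFn K) lam = ((n + 1 : ℕ) : ℕ∞)) :
    algMult (P1 K) lam = ((n + 1 : ℕ) : Cardinal) := by
  have hDan := analyticAt_charFn K.integrable lam
  have hD0 : charFn K lam = 0 :=
    apply_eq_zero_of_analyticOrderAt_ne_zero (by rw [hn]; simp)
  obtain ⟨E₀, hE₀, hE₀c⟩ := exists_P1_sub_eq K 0 (lam := lam) (c := 1)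
    (by rw [hD0, mul_zero, ← lapLin_apply, map_zero])
  -- A preimage with boundary value `0`, with junk value `0` for unsolvable `f`, so that the chain
  -- can be defined by plain iteration.
  have hstep : ∀ f : L2, ∃ g : (P1 K).domain, lap f lam = 0 →
      shifted (P1 K) lam g = f ∧ endLin K g = 0 := by
    intro f
    by_cases hf : lap f lam = 0
    · obtain ⟨g, hg, hc⟩ := exists_P1_sub_eq K f (lam := lam) (c := 0) (by rw [hf]; simp)
      exact ⟨g, fun _ => ⟨hg, hc⟩⟩
    · exact ⟨0, fun h => absurd h hf⟩
  choose S hS using hstep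
  let E : ℕ → (P1 K).domain := fun j => (fun g => S (g : L2))^[j] E₀
  have hEs : ∀ j, E (j + 1) = S (E j : L2) := fun j => Function.iterate_succ_apply' _ _ _
  have hlap : ∀ j ≤ n, ∀ z, (z - lam) ^ (j + 1) * lap (E j : L2) z = -Complex.I * charFn K z := by
    intro j hj
    induction j with
    | zero =>
      intro z
      have := lap_P1_sub K E₀ lam z
      rw [hE₀, hE₀c, ← lapLin_apply, map_zero] at this
      change _ * lap (E₀ : L2) z = _
      rw [zero_add, pow_one]
      linear_combination -this
    | succ j ih =>
      intro z
      have ih := ih (by omega)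
      have h0 : lap (E j : L2) lam = 0 :=
        (apply_eq_zero_iff_of_pow_mul_eq (by omega)
          (differentiable_lap (E j : L2).integrable).continuous.continuousAt hDan hn
          (neg_ne_zero.2 Complex.I_ne_zero) ih).2 (by omega)
      obtain ⟨h1, h2⟩ := hS (E j) h0
      have h3 := lap_P1_sub K (S (E j)) lam z
      rw [← shifted_apply, h1, ← endLin_apply, h2] at h3
      rw [hEs, ← ih, pow_succ, h3]
      ring
  -- `E j` has a preimage with boundary value `0` exactly for `j < n`; at `j = n` the transform is
  -- nonzero at `lam`, so `lapLin lam` serves as the obstruction `L`.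
  have hzero : ∀ j ≤ n, lap (E j : L2) lam = 0 ↔ j + 1 < n + 1 := fun j hj =>
    apply_eq_zero_iff_of_pow_mul_eq (by omega)
      (differentiable_lap (E j : L2).integrable).continuous.continuousAt hDan hn
      (neg_ne_zero.2 Complex.I_ne_zero) (hlap j hj)
  have hE : ∀ j < n, shifted (P1 K) lam (E (j + 1)) = (E j : L2) ∧ endLin K (E (j + 1)) = 0 :=
    fun j hj => hEs j ▸ hS (E j : L2) ((hzero j hj.le).2 (by omega))
  refine algMult_eq_of_chain (c := endLin K) (E := E) (fun f hf hc => ?_) hE₀c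
    (fun j hj => (hE j hj).2) hE₀ (fun j hj => (hE j hj).1) (lapLin lam) (fun f => ?_) ?_
  · exact eq_zero_of_P1_eq_smul (sub_eq_zero.1 hf) hc
  · rw [lapLin_apply, shifted_apply, lap_P1_sub, hD0]
    simp
  · exact fun h => absurd ((hzero n le_rfl).1 h) (lt_irrefl _)

/-! ### Location of the zeros of the characteristic function -/

theorem norm_exp_two_pi_I_mul (z : ℂ) :
    ‖Complex.exp (2 * Real.pi * Complex.I * z)‖ = Real.exp (-(2 * Real.pi * z.im)) := by
  rw [Complex.norm_exp]; simp

/-- Continuity of the logarithm at `1`: if `e^{2πiz}` is close to `1`, then `z` is close to an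
integer. -/
theorem exists_norm_sub_intCast_lt {δ : ℝ} (hδ : 0 < δ) :
    ∃ η : ℝ, 0 < η ∧ ∀ z : ℂ, ‖Complex.exp (2 * Real.pi * Complex.I * z) - 1‖ ≤ η * growth z →
      ∃ n : ℤ, ‖z - n‖ < δ := by
  have hlog : ContinuousAt Complex.log 1 := continuousAt_clog (by simp)
  obtain ⟨δ', hδ', hl⟩ := Metric.continuousAt_iff.1 hlog (2 * Real.pi * δ) (by positivity)
  -- With `growth z ≤ 2 + ‖u - 1‖` and `η ≤ 1/2` one gets `‖u - 1‖ ≤ 4η`, which is below `δ'` as `η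
  -- ≤ δ'/5`.
  refine ⟨min (1 / 2) (δ' / 5), by positivity, fun z hz => ?_⟩
  set η := min (1 / 2) (δ' / 5)
  have h1 : η ≤ 1 / 2 := min_le_left _ _
  have h2 : η ≤ δ' / 5 := min_le_right _ _
  have hη : 0 < η := by positivity
  set u := Complex.exp (2 * Real.pi * Complex.I * z)
  have h3 : growth z ≤ 2 + ‖u - 1‖ := by
    have e : growth z = 1 + ‖u‖ := by rw [growth, ← norm_exp_two_pi_I_mul]
    have : ‖u‖ ≤ ‖u - 1‖ + 1 := by simpa using norm_add_le (u - 1) 1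
    linarith
  have h4 : ‖u - 1‖ < δ' := by nlinarith [norm_nonneg (u - 1)]
  have h5 := hl (by rwa [dist_eq_norm])
  rw [Complex.log_one, dist_zero_right] at h5
  have h6 : Complex.exp (2 * Real.pi * Complex.I * z) = Complex.exp (Complex.log u) :=
    (Complex.exp_log (Complex.exp_ne_zero _)).symm
  obtain ⟨n, hn⟩ := Complex.exp_eq_exp_iff_exists_int.1 h6
  refine ⟨n, ?_⟩
  have h7 : 2 * Real.pi * Complex.I * (z - n) = Complex.log u := by rw [mul_sub, hn]; ring
  have h8 : 2 * Real.pi * ‖z - n‖ = ‖Complex.log u‖ := by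
    rw [← h7]
    simp [abs_of_pos Real.pi_pos]
  rw [← h8] at h5
  exact lt_of_mul_lt_mul_left h5 (by positivity)

/-- At a zero `|e^{2πiz} - 1| = |s lap K z|`, which is small relative to `growth z`. Uniformity in
`s` serves the homotopy. -/
theorem exists_zeros_near_intCast {K : ℝ → ℂ} (hK : Integrable K mu) {δ : ℝ} (hδ : 0 < δ) :
    ∃ R : ℝ, 0 < R ∧ ∀ s : ℂ, ‖s‖ ≤ 1 → ∀ z : ℂ, R ≤ ‖z‖ → charFn (fun t => s * K t) z = 0 →
      ∃ n : ℤ, ‖z - n‖ < δ := by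
  obtain ⟨η, hη, h⟩ := exists_norm_sub_intCast_lt hδ
  obtain ⟨R, hR, hl⟩ := exists_norm_lap_le hK hη
  refine ⟨R, hR, fun s hs z hz h0 => h z ?_⟩
  rw [charFn, sub_eq_zero, lap_const_mul] at h0
  rw [h0, norm_mul, Complex.norm_I, one_mul, norm_mul]
  calc ‖s‖ * ‖lap K z‖ ≤ 1 * ‖lap K z‖ := by gcongr
    _ ≤ η * growth z := by rw [one_mul]; exact hl z hz

/-- Otherwise `D ≡ 0` and `i(R + 1)` would be a large zero at distance more than `1` from every
integer. -/
theorem analyticOrderAt_charFn_ne_top {K : ℝ → ℂ} (hK : Integrable K mu) (z : ℂ) :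
    analyticOrderAt (charFn K) z ≠ ⊤ := by
  intro h
  have han : AnalyticOnNhd ℂ (charFn K) univ := fun z _ => analyticAt_charFn hK z
  have h0 : charFn K = 0 := by
    have := han.eqOn_zero_of_preconnected_of_eventuallyEq_zero isPreconnected_univ (mem_univ z)
      (analyticOrderAt_eq_top.1 h)
    exact funext fun w => this (mem_univ w)
  obtain ⟨R, hR, hz⟩ := exists_zeros_near_intCast hK one_pos
  obtain ⟨n, hn⟩ := hz 1 (by simp) (((R + 1 : ℝ) : ℂ) * Complex.I)
    (by simp only [norm_mul, Complex.norm_real, Complex.norm_I, mul_one, Real.norm_eq_abs]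
        exact (by linarith : R ≤ R + 1).trans (le_abs_self _))
    (by simp only [one_mul]; exact congrFun h0 _)
  have h1 := (le_abs_self _).trans (Complex.abs_im_le_norm (((R + 1 : ℝ) : ℂ) * Complex.I - n))
  simp at h1
  have h2 : ‖((R + 1 : ℝ) : ℂ) * Complex.I - n‖ = ‖(R + 1) * Complex.I - n‖ := by push_cast; rfl
  linarith

/-! ### A quantitative inverse function theorem on a disk -/

section LocalInverse

variable {f : ℂ → ℂ} {z₀ a : ℂ} {δ : ℝ}

/-- The mean value inequality for `f z - a z` on the convex ball. -/
theorem norm_sub_smul_sub_le (hf : Differentiable ℂ f)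
    (h : ∀ z ∈ Metric.ball z₀ δ, ‖deriv f z - a‖ ≤ ‖a‖ / 6) {z w : ℂ}
    (hz : z ∈ Metric.ball z₀ δ) (hw : w ∈ Metric.ball z₀ δ) :
    ‖(f z - f w) - a * (z - w)‖ ≤ ‖a‖ / 6 * ‖z - w‖ := by
  have hd : ∀ x, HasDerivAt (fun z => f z - a * z) (deriv f x - a) x := fun x =>
    ((hf x).hasDerivAt.sub ((hasDerivAt_id x).const_mul a)).congr_deriv (by simp)
  have := (convex_ball z₀ δ).norm_image_sub_le_of_norm_hasDerivWithin_le
    (fun x _ => (hd x).hasDerivWithinAt) h hw hz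
  rwa [show f z - f w - a * (z - w) = f z - a * z - (f w - a * w) by ring]

theorem eq_of_zeros_of_norm_deriv_sub_le (ha : a ≠ 0) (hf : Differentiable ℂ f)
    (h : ∀ z ∈ Metric.ball z₀ δ, ‖deriv f z - a‖ ≤ ‖a‖ / 6) {z w : ℂ}
    (hz : z ∈ Metric.ball z₀ δ) (hw : w ∈ Metric.ball z₀ δ) (hfz : f z = 0) (hfw : f w = 0) :
    z = w := by
  have := norm_sub_smul_sub_le hf h hz hw
  rw [hfz, hfw, sub_zero, zero_sub, norm_neg, norm_mul] at this
  have ha' : 0 < ‖a‖ := norm_pos_iff.2 ha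
  have h0 : ‖z - w‖ ≤ 0 := by
    by_contra hc
    have := mul_pos ha' (not_le.1 hc)
    linarith
  exact sub_eq_zero.1 (norm_le_zero_iff.1 h0)

/-- The factor is `6/5 = 1/(1 - 1/6)`. -/
theorem norm_zero_sub_le_of_norm_deriv_sub_le (hf : Differentiable ℂ f)
    (h : ∀ z ∈ Metric.ball z₀ δ, ‖deriv f z - a‖ ≤ ‖a‖ / 6) {z : ℂ}
    (hz : z ∈ Metric.ball z₀ δ) (hfz : f z = 0) : ‖a‖ * ‖z - z₀‖ ≤ 6 / 5 * ‖f z₀‖ := by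
  have hδ : 0 < δ := dist_nonneg.trans_lt hz
  have h1 := norm_sub_smul_sub_le hf h hz (Metric.mem_ball_self hδ)
  rw [hfz, zero_sub] at h1
  have h2 : ‖a * (z - z₀)‖ ≤ ‖-f z₀ - a * (z - z₀)‖ + ‖f z₀‖ := by
    have := norm_sub_le (-(-f z₀ - a * (z - z₀))) (f z₀)
    rwa [norm_neg, show -(-f z₀ - a * (z - z₀)) - f z₀ = a * (z - z₀) by ring] at this
  rw [norm_mul] at h2
  linarith

theorem deriv_ne_zero_of_norm_deriv_sub_le (ha : a ≠ 0)
    (h : ∀ z ∈ Metric.ball z₀ δ, ‖deriv f z - a‖ ≤ ‖a‖ / 6) {z : ℂ}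
    (hz : z ∈ Metric.ball z₀ δ) : deriv f z ≠ 0 := by
  intro h0
  have := h z hz
  rw [h0, zero_sub, norm_neg] at this
  have ha' : 0 < ‖a‖ := norm_pos_iff.2 ha
  linarith

/-- The Newton map with frozen slope, `z - f z / a`, contracts by `1/6`. It moves the centre by half
the radius `r`, and `r/6 + r/2 ≤ r`, so the closed ball is mapped into itself. -/
theorem exists_zero_of_norm_deriv_sub_le (ha : a ≠ 0) (hf : Differentiable ℂ f)
    (h : ∀ z ∈ Metric.ball z₀ δ, ‖deriv f z - a‖ ≤ ‖a‖ / 6) (h0 : 2 * ‖f z₀‖ / ‖a‖ < δ) :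
    ∃ z ∈ Metric.ball z₀ δ, f z = 0 := by
  have ha' : 0 < ‖a‖ := norm_pos_iff.2 ha
  set r := 2 * ‖f z₀‖ / ‖a‖ with hr
  have hr0 : 0 ≤ r := by positivity
  have hsub : Metric.closedBall z₀ r ⊆ Metric.ball z₀ δ := Metric.closedBall_subset_ball h0
  set T : ℂ → ℂ := fun z => z - f z / a
  have hT : ∀ z ∈ Metric.ball z₀ δ, ∀ w ∈ Metric.ball z₀ δ, ‖T z - T w‖ ≤ 1 / 6 * ‖z - w‖ := by
    intro z hz w hw
    have h1 := norm_sub_smul_sub_le hf h hz hw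
    have h2 : T z - T w = -((f z - f w) - a * (z - w)) / a := by
      simp only [T]; field_simp; ring
    rw [h2, norm_div, norm_neg, div_le_iff₀ ha']
    linarith
  have hz₀ : z₀ ∈ Metric.closedBall z₀ r := Metric.mem_closedBall_self hr0
  have hmaps : MapsTo T (Metric.closedBall z₀ r) (Metric.closedBall z₀ r) := by
    intro z hz
    have h1 := hT z (hsub hz) z₀ (hsub hz₀)
    rw [mem_closedBall_iff_norm] at hz ⊢
    have h2 : ‖T z₀ - z₀‖ = r / 2 := by
      simp only [T, hr, sub_sub_cancel_left, norm_neg, norm_div]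
      ring
    calc ‖T z - z₀‖ = ‖(T z - T z₀) + (T z₀ - z₀)‖ := by congr 1; ring
      _ ≤ ‖T z - T z₀‖ + ‖T z₀ - z₀‖ := norm_add_le _ _
      _ ≤ r := by linarith
  have hc : ContractingWith (1 / 6) (hmaps.restrict T _ _) := by
    refine ⟨by rw [← NNReal.coe_lt_coe]; norm_num, LipschitzWith.of_dist_le_mul fun z w => ?_⟩
    have := hT z (hsub z.2) w (hsub w.2)
    rw [Subtype.dist_eq, Subtype.dist_eq, dist_eq_norm, dist_eq_norm]
    simpa using this
  obtain ⟨z, hz, hfix, -⟩ := hc.exists_fixedPoint' Metric.isClosed_closedBall.isComplete hmaps hz₀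
    (edist_ne_top _ _)
  refine ⟨z, hsub hz, ?_⟩
  have : z - f z / a = z := hfix
  have : f z / a = 0 := by linear_combination -this
  exact (div_eq_zero_iff.1 this).resolve_right ha

end LocalInverse

/-! ### The characteristic function near the integers -/

theorem hasDerivAt_charFn {K : ℝ → ℂ} (hK : Integrable K mu) (z : ℂ) :
    HasDerivAt (charFn K) (2 * Real.pi * Complex.I * Complex.exp (2 * Real.pi * Complex.I * z)
      - Complex.I * lap (fun t => Complex.I * t * K t) z) z := by
  have h1 : HasDerivAt (fun z : ℂ => 2 * Real.pi * Complex.I * z) (2 * Real.pi * Complex.I) z := by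
    simpa using (hasDerivAt_id z).const_mul (2 * Real.pi * Complex.I)
  exact ((h1.cexp.sub_const 1).sub ((hasDerivAt_lap hK z).const_mul _)).congr_deriv (by ring)

theorem exp_two_pi_I_mul_intCast_add (n : ℤ) (w : ℂ) :
    Complex.exp (2 * Real.pi * Complex.I * (n + w)) = Complex.exp (2 * Real.pi * Complex.I * w) := by
  rw [Complex.exp_eq_exp_iff_exists_int]
  exact ⟨n, by ring⟩

theorem charFn_intCast (K : ℝ → ℂ) (n : ℤ) : charFn K n = -(Complex.I * lap K n) := by
  have := exp_two_pi_I_mul_intCast_add n 0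
  rw [add_zero, mul_zero, Complex.exp_zero] at this
  rw [charFn, this]
  ring

theorem norm_two_pi_I : ‖(2 * Real.pi * Complex.I : ℂ)‖ = 2 * Real.pi := by
  simp [abs_of_pos Real.pi_pos]

/-- Near integers of large modulus, the derivative of the characteristic function is close to
`2πi`. -/
theorem exists_norm_deriv_charFn_sub_le {K : ℝ → ℂ} (hK : Integrable K mu) :
    ∃ δ : ℝ, 0 < δ ∧ δ ≤ 1 / 10 ∧ ∃ M : ℝ, ∀ n : ℤ, M ≤ |(n : ℝ)| → ‖lap K n‖ ≤ 2 * δ ∧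
      ∀ z ∈ Metric.ball (n : ℂ) δ, ‖deriv (charFn K) z - 2 * Real.pi * Complex.I‖
        ≤ ‖(2 * Real.pi * Complex.I : ℂ)‖ / 6 := by
  have hcont : ContinuousAt (fun w : ℂ => 2 * Real.pi * Complex.I *
      Complex.exp (2 * Real.pi * Complex.I * w)) 0 := by fun_prop
  -- Error budget: `1/2` from the exponential and `4 · 1/8` from the Laplace term (`growth z ≤ 4`
  -- near the real axis), in total `1 ≤ 2π/6`.
  obtain ⟨δ', hδ', hc⟩ := Metric.continuousAt_iff.1 hcont (1 / 2) (by norm_num)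
  set δ := min δ' (1 / 10)
  have hδ : 0 < δ := by positivity
  obtain ⟨R₁, -, h1⟩ := exists_norm_lap_le hK hδ
  obtain ⟨R₂, -, h2⟩ := exists_norm_lap_le (Integrable.I_mul_id_mul hK) (by norm_num : (0:ℝ) < 1 / 8)
  refine ⟨δ, hδ, min_le_right _ _, max R₁ (R₂ + 1), fun n hn => ⟨?_, fun z hz => ?_⟩⟩
  · have := h1 n (by rw [Complex.norm_intCast]; exact (le_max_left _ _).trans hn)
    have hg : growth (n : ℂ) = 2 := by simp [growth]; norm_num
    rw [hg] at this
    linarith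
  · have hz' : ‖z - n‖ < δ := by rwa [mem_ball_iff_norm] at hz
    have hz1 : ‖z - n‖ < δ' := hz'.trans_le (min_le_left _ _)
    have hz2 : ‖z - n‖ < 1 / 10 := hz'.trans_le (min_le_right _ _)
    rw [(hasDerivAt_charFn hK z).deriv]
    have e1 : ‖2 * Real.pi * Complex.I * Complex.exp (2 * Real.pi * Complex.I * z)
        - 2 * Real.pi * Complex.I‖ < 1 / 2 := by
      have := hc (x := z - n) (by simpa using hz1)
      rw [dist_eq_norm, mul_zero, Complex.exp_zero, mul_one] at this
      rwa [← exp_two_pi_I_mul_intCast_add n, add_sub_cancel] at this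
    have e2 := h2 z (by
      have h3 : R₂ + 1 ≤ ‖(n : ℂ)‖ := by
        rw [Complex.norm_intCast]; exact (le_max_right _ _).trans hn
      have h4 : ‖(n : ℂ)‖ ≤ ‖z‖ + ‖z - n‖ := by
        have := norm_sub_le z (z - n)
        rwa [sub_sub_cancel] at this
      linarith)
    have e3 : growth z ≤ 4 := by
      have h3 : |z.im| ≤ 1 / 10 := by
        have := Complex.abs_im_le_norm (z - n)
        simp at this
        linarith
      have h4 : -(2 * Real.pi * z.im) ≤ 1 := by
        have := (abs_le.1 h3).1
        nlinarith [Real.pi_pos, Real.pi_lt_d2]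
      have h5 := Real.exp_le_exp.2 h4
      have h6 := Real.exp_one_lt_d9
      unfold growth
      linarith
    rw [norm_two_pi_I]
    have hpi := Real.pi_gt_three
    rw [sub_right_comm]
    refine (norm_sub_le _ _).trans ?_
    rw [norm_mul, Complex.norm_I, one_mul]
    linarith

/-- The Fourier coefficients of `K` are the values of its Laplace transform at the integers. -/
theorem inner_psi (K : L2) (n : ℤ) :
    inner ℂ (psi n) K = ((1 / Real.sqrt (2 * Real.pi) : ℝ) : ℂ) * lap K n := by
  rw [L2.inner_def, lap, ← integral_const_mul]
  refine integral_congr_ae ?_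
  filter_upwards [(psiFun_memLp n).coeFn_toLp] with x hx
  rw [psi, hx, psiFun, RCLike.inner_apply, map_mul, Complex.conj_ofReal, ← Complex.exp_conj]
  have : (starRingEnd ℂ) (-(Complex.I * n * x)) = Complex.I * n * x := by
    simp
  rw [this]
  ring

theorem norm_inner_psi (K : L2) (n : ℤ) :
    ‖lap K n‖ = Real.sqrt (2 * Real.pi) * ‖(inner ℂ (psi n) K : ℂ)‖ := by
  have : 0 < Real.sqrt (2 * Real.pi) := Real.sqrt_pos.2 (by positivity)
  rw [inner_psi, norm_mul, Complex.norm_real, Real.norm_of_nonneg (by positivity)]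
  field_simp

/-! ### Counting zeros in a disk by Jensen's formula -/

/-- The number of zeros of an entire function in the closed disk of radius `r` around `0`,
counted with multiplicity. -/
def zeroCount (F : ℂ → ℂ) (r : ℝ) : ℤ :=
  ∑ᶠ u, MeromorphicOn.divisor F (Metric.closedBall 0 r) u

/-- Both sides assign the value `0` to infinite order, so `F` may vanish identically. -/
theorem Differentiable.divisor_apply {F : ℂ → ℂ} (hF : Differentiable ℂ F) {U : Set ℂ} {u : ℂ}
    (hu : u ∈ U) : MeromorphicOn.divisor F U u = analyticOrderNatAt F u := by
  rw [MeromorphicOn.AnalyticOnNhd.divisor_apply (fun z _ => hF.analyticAt z) hu,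
    analyticOrderNatAt]
  cases h : analyticOrderAt F u <;> rfl

theorem Differentiable.zeroCount_eq_sum {F : ℂ → ℂ} (hF : Differentiable ℂ F) {r : ℝ}
    {S : Finset ℂ} (hS : ∀ u, ‖u‖ ≤ r → F u = 0 → u ∈ S) (hS' : ∀ u ∈ S, ‖u‖ ≤ r) :
    zeroCount F r = ∑ u ∈ S, (analyticOrderNatAt F u : ℤ) := by
  have hsupp : (fun u => MeromorphicOn.divisor F (Metric.closedBall 0 r) u).support ⊆ S := by
    intro u hu
    have hur : u ∈ Metric.closedBall (0 : ℂ) r :=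
      (MeromorphicOn.divisor F (Metric.closedBall 0 r)).supportWithinDomain hu
    rw [Function.mem_support, hF.divisor_apply hur] at hu
    refine hS u (by simpa using hur) (apply_eq_zero_of_analyticOrderAt_ne_zero fun h => hu ?_)
    simp [analyticOrderNatAt, h]
  rw [zeroCount, finsum_eq_sum_of_support_subset _ hsupp]
  exact Finset.sum_congr rfl fun u hu => hF.divisor_apply (by simpa using hS' u hu)

theorem Differentiable.finite_zeros {F : ℂ → ℂ} (hF : Differentiable ℂ F)
    (htop : ∀ z, analyticOrderAt F z ≠ ⊤) (r : ℝ) : {u | ‖u‖ ≤ r ∧ F u = 0}.Finite := by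
  refine ((MeromorphicOn.divisor F (Metric.closedBall 0 r)).finiteSupport
    (isCompact_closedBall 0 r)).subset fun u hu => ?_
  have hur : u ∈ Metric.closedBall (0 : ℂ) r := by simpa using hu.1
  rw [Function.mem_support, hF.divisor_apply hur]
  have h1 := (hF.analyticAt u).analyticOrderAt_ne_zero.2 hu.2
  rw [← Nat.cast_analyticOrderNatAt (htop u)] at h1
  exact_mod_cast h1

/-- Jensen's formula. The convention `log 0 = 0` lets a zero at the origin be included in the sum,
with contribution `log r` per multiplicity. -/
theorem Differentiable.circleAverage_log_norm_eq {F : ℂ → ℂ} (hF : Differentiable ℂ F) {r : ℝ}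
    (hr : 0 < r) : Real.circleAverage (fun z => Real.log ‖F z‖) 0 r =
      ∑ᶠ u, MeromorphicOn.divisor F (Metric.closedBall 0 r) u * (Real.log r - Real.log ‖0 - u‖)
        + Real.log ‖meromorphicTrailingCoeffAt F 0‖ := by
  have h1 := MeromorphicOn.circleAverage_log_norm (c := 0) (f := F) hr.ne'
    (fun z _ => (hF.analyticAt z).meromorphicAt)
  rw [abs_of_pos hr] at h1
  rw [h1, countingFunction_finsum_eq_finsum_add hr.ne'
    ((MeromorphicOn.divisor F (Metric.closedBall 0 r)).finiteSupport (isCompact_closedBall 0 r))]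

/-- The increment of the logarithmic mean over an annulus without zeros counts the zeros inside. -/
theorem Differentiable.circleAverage_log_norm_sub {F : ℂ → ℂ} (hF : Differentiable ℂ F)
    {r₁ r₂ : ℝ} (h1 : 0 < r₁) (h12 : r₁ < r₂) (h0 : ∀ z, r₁ ≤ ‖z‖ → ‖z‖ ≤ r₂ → F z ≠ 0) :
    Real.circleAverage (fun z => Real.log ‖F z‖) 0 r₂
      - Real.circleAverage (fun z => Real.log ‖F z‖) 0 r₁ =
      zeroCount F r₂ * (Real.log r₂ - Real.log r₁) := by
  have hD : ∀ u, MeromorphicOn.divisor F (Metric.closedBall 0 r₁) u =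
      MeromorphicOn.divisor F (Metric.closedBall 0 r₂) u := by
    intro u
    by_cases hu1 : u ∈ Metric.closedBall (0 : ℂ) r₁
    · rw [hF.divisor_apply hu1,
        hF.divisor_apply (Metric.closedBall_subset_closedBall h12.le hu1)]
    · rw [Function.locallyFinsuppWithin.apply_eq_zero_of_notMem _ hu1]
      by_cases hu2 : u ∈ Metric.closedBall (0 : ℂ) r₂
      · rw [hF.divisor_apply hu2, analyticOrderNatAt,
          (hF.analyticAt u).analyticOrderAt_eq_zero.2 (h0 u ?_ (by simpa using hu2))]
        · rfl
        · rw [Metric.mem_closedBall, dist_zero_right, not_le] at hu1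
          exact hu1.le
      · rw [Function.locallyFinsuppWithin.apply_eq_zero_of_notMem _ hu2]
  have hfin := (MeromorphicOn.divisor F (Metric.closedBall 0 r₂)).finiteSupport
    (isCompact_closedBall 0 r₂)
  have hfin' : ∀ g : ℂ → ℝ, (Function.support fun u =>
      (MeromorphicOn.divisor F (Metric.closedBall 0 r₂) u : ℝ) * g u) ⊆ hfin.toFinset := by
    intro g u hu
    simp only [Finite.coe_toFinset, Function.mem_support]
    intro h
    apply hu
    simp [h]
  -- In the difference the trailing coefficient and every `log ‖u‖` cancel, leaving `log r₂ - log
  -- r₁` for each zero.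
  rw [hF.circleAverage_log_norm_eq (h1.trans h12), hF.circleAverage_log_norm_eq h1]
  simp only [hD]
  rw [finsum_eq_sum_of_support_subset _ (hfin' _), finsum_eq_sum_of_support_subset _ (hfin' _),
    zeroCount, finsum_eq_sum_of_support_subset (s := hfin.toFinset) _ (by simp),
    Int.cast_sum, Finset.sum_mul, add_sub_add_right_eq_sub, ← Finset.sum_sub_distrib]
  exact Finset.sum_congr rfl fun u _ => by ring

/-- The number of zeros is invariant under a homotopy without zeros in an annulus. -/
theorem zeroCount_add_eq {G h : ℂ → ℂ} (hG : Differentiable ℂ G) (hh : Differentiable ℂ h)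
    {r₁ r₂ : ℝ} (h1 : 0 < r₁) (h12 : r₁ < r₂)
    (h0 : ∀ s : unitInterval, ∀ z, r₁ ≤ ‖z‖ → ‖z‖ ≤ r₂ → G z + (s : ℝ) * h z ≠ 0) :
    zeroCount (fun z => G z + h z) r₂ = zeroCount G r₂ := by
  set F : unitInterval → ℂ → ℂ := fun s z => G z + ((s : ℝ) : ℂ) * h z
  have hF : ∀ s, Differentiable ℂ (F s) := fun s => hG.add (hh.const_mul _)
  have hGc := hG.continuous
  have hhc := hh.continuous
  have hcont : ∀ r, r₁ ≤ r → r ≤ r₂ →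
      Continuous fun s => Real.circleAverage (fun z => Real.log ‖F s z‖) 0 r := by
    intro r hr hr'
    simp only [Real.circleAverage, smul_eq_mul]
    apply continuous_const.mul
    refine intervalIntegral.continuous_parametric_intervalIntegral_of_continuous' (μ := volume)
      (f := fun s θ => Real.log ‖F s (circleMap 0 r θ)‖) ?_ _ _
    have : Continuous fun p : unitInterval × ℝ => ‖F p.1 (circleMap 0 r p.2)‖ := by
      unfold F
      fun_prop
    refine this.log fun p => norm_ne_zero_iff.2 (h0 p.1 _ ?_ ?_)
    all_goals rw [norm_circleMap_zero, abs_of_pos (h1.trans_le hr)]; assumption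
  have hlog : Real.log r₂ - Real.log r₁ ≠ 0 := (sub_pos.2 (Real.log_lt_log h1 h12)).ne'
  -- By Jensen the count is a quotient of quantities continuous in `s`; being integer-valued on a
  -- connected interval, it is constant.
  have hc : Continuous fun s => ((zeroCount (F s) r₂ : ℤ) : ℝ) := by
    have e : (fun s => ((zeroCount (F s) r₂ : ℤ) : ℝ)) = fun s =>
        (Real.circleAverage (fun z => Real.log ‖F s z‖) 0 r₂
          - Real.circleAverage (fun z => Real.log ‖F s z‖) 0 r₁) / (Real.log r₂ - Real.log r₁) := by
      ext s
      rw [(hF s).circleAverage_log_norm_sub h1 h12 (h0 s), mul_div_cancel_right₀ _ hlog]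
    rw [e]
    exact ((hcont r₂ h12.le le_rfl).sub (hcont r₁ le_rfl h12.le)).div_const _
  have hc' : Continuous fun s => zeroCount (F s) r₂ :=
    Int.isClosedEmbedding_coe_real.isInducing.continuous_iff.2 hc
  have := PreconnectedSpace.constant inferInstance hc' (x := 1) (y := 0)
  simpa [F] using this

theorem charFn_smul (K : ℝ → ℂ) (s z : ℂ) :
    charFn (fun t => s * K t) z =
      (Complex.exp (2 * Real.pi * Complex.I * z) - 1) + s * (-Complex.I * lap K z) := by
  rw [charFn, lap_const_mul]
  ring

theorem exp_two_pi_I_mul_sub_one_eq_zero_iff {z : ℂ} :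
    Complex.exp (2 * Real.pi * Complex.I * z) - 1 = 0 ↔ ∃ n : ℤ, z = n := by
  rw [sub_eq_zero, Complex.exp_eq_one_iff]
  refine exists_congr fun n => ?_
  rw [mul_comm (2 * (Real.pi : ℂ) * Complex.I) z]
  exact mul_left_inj' Complex.two_pi_I_ne_zero

theorem analyticOrderNatAt_eq_one {f : ℂ → ℂ} (hf : Differentiable ℂ f) {z : ℂ} (h0 : f z = 0)
    (h1 : deriv f z ≠ 0) : analyticOrderNatAt f z = 1 := by
  rw [analyticOrderNatAt, (hf.analyticAt z).analyticOrderAt_eq_one_of_zero_deriv_ne_zero h0 h1]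
  rfl

theorem zeroCount_exp_sub_one {N : ℕ} {r : ℝ} (h1 : (N : ℝ) ≤ r) (h2 : r < N + 1) :
    zeroCount (fun z => Complex.exp (2 * Real.pi * Complex.I * z) - 1) r = 2 * N + 1 := by
  have hd : Differentiable ℂ fun z : ℂ => Complex.exp (2 * Real.pi * Complex.I * z) - 1 := by
    fun_prop
  have hinj : Function.Injective fun n : ℤ => (n : ℂ) := Int.cast_injective
  rw [hd.zeroCount_eq_sum (S := (Finset.Icc (-(N : ℤ)) N).image fun n : ℤ => (n : ℂ))]
  · rw [Finset.sum_image fun a _ b _ h => hinj h, Finset.sum_congr rfl (g := fun _ => 1)]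
    · simp; omega
    · intro n _
      rw [analyticOrderNatAt_eq_one hd (exp_two_pi_I_mul_sub_one_eq_zero_iff.2 ⟨n, rfl⟩)]
      · rfl
      · have : HasDerivAt (fun z : ℂ => 2 * Real.pi * Complex.I * z) (2 * Real.pi * Complex.I) n := by
          simpa using (hasDerivAt_id (n : ℂ)).const_mul (2 * Real.pi * Complex.I)
        rw [(this.cexp.sub_const 1).deriv]
        exact mul_ne_zero (Complex.exp_ne_zero _) Complex.two_pi_I_ne_zero
  · intro u hu h0
    obtain ⟨n, rfl⟩ := exp_two_pi_I_mul_sub_one_eq_zero_iff.1 h0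
    rw [Complex.norm_intCast] at hu
    refine Finset.mem_image.2 ⟨n, ?_, rfl⟩
    have h3 : |n| < (N : ℤ) + 1 := by exact_mod_cast hu.trans_lt h2
    rw [Finset.mem_Icc, ← abs_le]
    omega
  · intro u hu
    obtain ⟨n, hn, rfl⟩ := Finset.mem_image.1 hu
    rw [Complex.norm_intCast]
    rw [Finset.mem_Icc, ← abs_le] at hn
    refine le_trans ?_ h1
    exact_mod_cast hn

/-! ### The eigenvalues of `P1 K` -/

theorem algMult_P1_eq_analyticOrderNatAt (K : L2) {lam : ℂ} (h : charFn K lam = 0) :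
    algMult (P1 K) lam = (analyticOrderNatAt (charFn K) lam : Cardinal) := by
  have h1 := Nat.cast_analyticOrderNatAt (analyticOrderAt_charFn_ne_top K.integrable lam)
  have h2 := (analyticAt_charFn K.integrable lam).analyticOrderAt_ne_zero.2 h
  obtain ⟨n, hn⟩ : ∃ n, analyticOrderNatAt (charFn K) lam = n + 1 := by
    refine Nat.exists_eq_succ_of_ne_zero fun h3 => h2 ?_
    rw [← h1, h3]
    rfl
  rw [hn, algMult_P1 K]
  rw [← h1, hn]

theorem abs_intCast_le_or (n : ℤ) (N : ℕ) :
    |(n : ℝ)| ≤ N ∨ (N : ℝ) + 1 ≤ |(n : ℝ)| ∧ (N : ℤ) < |n| := by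
  rcases le_or_gt |n| (N : ℤ) with h | h
  · left
    exact_mod_cast h
  · right
    refine ⟨?_, h⟩
    have : (N : ℤ) + 1 ≤ |n| := h
    exact_mod_cast this

theorem abs_norm_sub_abs_intCast_lt {z : ℂ} {n : ℤ} {δ : ℝ} (h : ‖z - n‖ < δ) :
    abs (‖z‖ - abs (n : ℝ)) < δ := by
  rw [← Complex.norm_intCast]
  exact (abs_norm_sub_norm_le _ _).trans_lt h

/-- Near each integer of large modulus there is exactly one zero of the characteristic function;
it is simple, and its distance to the integer is controlled by the Fourier coefficient. -/
theorem exists_local_zeros (K : L2) :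
    ∃ δ : ℝ, 0 < δ ∧ δ ≤ 1 / 10 ∧ ∃ M : ℝ, ∀ n : ℤ, M ≤ |(n : ℝ)| →
      ‖(inner ℂ (psi n) K : ℂ)‖ < δ ∧
      ∃ lam : ℂ, ‖lam - n‖ ≤ ‖(inner ℂ (psi n) K : ℂ)‖ / 2 ∧ charFn K lam = 0 ∧
        analyticOrderNatAt (charFn K) lam = 1 ∧
        ∀ z ∈ Metric.ball (n : ℂ) δ, charFn K z = 0 → z = lam := by
  obtain ⟨δ, hδ, hδ', M, hM⟩ := exists_norm_deriv_charFn_sub_le K.integrable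
  refine ⟨δ, hδ, hδ', M, fun n hn => ?_⟩
  obtain ⟨h1, h2⟩ := hM n hn
  have hD := differentiable_charFn K.integrable
  have ha := Complex.two_pi_I_ne_zero
  have hpi := Real.pi_gt_three
  -- Chosen so that `(6/5)/√(2π) ≤ 1/2`; `(12/5)² < 6 < 2π`.
  have hs : 12 / 5 ≤ Real.sqrt (2 * Real.pi) := Real.le_sqrt_of_sq_le (by nlinarith)
  have hss : Real.sqrt (2 * Real.pi) * Real.sqrt (2 * Real.pi) = 2 * Real.pi :=
    Real.mul_self_sqrt (by positivity)
  have hk := norm_inner_psi K n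
  have hDn : ‖charFn K n‖ = ‖lap K n‖ := by
    rw [charFn_intCast, norm_neg, norm_mul, Complex.norm_I, one_mul]
  set s := Real.sqrt (2 * Real.pi)
  set k := ‖(inner ℂ (psi n) K : ℂ)‖
  have hk0 : 0 ≤ k := norm_nonneg _
  -- The required smallness is `2‖D(n)‖/(2π) ≤ 4δ/(2π) < δ`.
  obtain ⟨lam, hlam, hlam0⟩ := exists_zero_of_norm_deriv_sub_le ha hD h2 (by
    rw [hDn, norm_two_pi_I, div_lt_iff₀ (by positivity)]
    nlinarith)
  refine ⟨by nlinarith, lam, ?_, hlam0, analyticOrderNatAt_eq_one hD hlam0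
    (deriv_ne_zero_of_norm_deriv_sub_le ha h2 hlam), fun z hz hz0 =>
    eq_of_zeros_of_norm_deriv_sub_le ha hD h2 hz hlam hz0 hlam0⟩
  have h3 := norm_zero_sub_le_of_norm_deriv_sub_le hD h2 hlam hlam0
  rw [norm_two_pi_I, hDn, hk, ← hss] at h3
  have h4 : s * ‖lam - n‖ ≤ 6 / 5 * k := by
    refine le_of_mul_le_mul_left (a := s) ?_ (by linarith)
    linarith
  nlinarith [norm_nonneg (lam - n)]

/-- Deforming `sK` from `s = 1` to `s = 0` keeps the count and ends at `e^{2πiz} - 1`. -/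
theorem sum_analyticOrderNatAt_charFn {K : ℝ → ℂ} (hK : Integrable K mu) {N : ℕ}
    (h : ∀ s : ℂ, ‖s‖ ≤ 1 → ∀ z : ℂ, (N : ℝ) + 3 / 10 ≤ ‖z‖ → ‖z‖ ≤ N + 7 / 10 →
      charFn (fun t => s * K t) z ≠ 0)
    {S : Finset ℂ} (hS : ∀ z, z ∈ S ↔ ‖z‖ ≤ N + 7 / 10 ∧ charFn K z = 0) :
    ∑ z ∈ S, analyticOrderNatAt (charFn K) z = 2 * N + 1 := by
  have h1 := (differentiable_charFn hK).zeroCount_eq_sum (r := N + 7 / 10) (S := S)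
    (fun z h1 h2 => (hS z).2 ⟨h1, h2⟩) fun z hz => ((hS z).1 hz).1
  have hd : Differentiable ℂ fun z : ℂ => Complex.exp (2 * Real.pi * Complex.I * z) - 1 := by
    fun_prop
  have h2 := zeroCount_add_eq hd ((differentiable_lap hK).const_mul (-Complex.I))
    (r₁ := N + 3 / 10) (r₂ := N + 7 / 10) (by positivity) (by linarith) (fun s z h1 h2 => by
      rw [← charFn_smul]
      refine h _ ?_ z h1 h2
      rw [Complex.norm_real, Real.norm_of_nonneg s.2.1]
      exact s.2.2)
  have h3 : charFn K = fun z => (Complex.exp (2 * Real.pi * Complex.I * z) - 1)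
      + -Complex.I * lap K z := by
    ext z
    rw [charFn]
    ring
  rw [← h3, h1, zeroCount_exp_sub_one (N := N) (by linarith) (by linarith)] at h2
  exact_mod_cast h2

end

theorem theorem3p14 (K : L2) :
    ∃ (N₀ : ℕ) (b₀ : ℝ), 0 < b₀ ∧ ∀ N : ℕ, N₀ ≤ N → ∀ b : ℝ, b₀ ≤ b →
      (∃ S : Finset ℂ,
          (∀ lam : ℂ, lam ∈ S ↔ IsEigenvalue (P1 K) lam ∧ lam ∈ rect N b) ∧
          ∑ lam ∈ S, algMult (P1 K) lam = ((2 * N + 1 : ℕ) : Cardinal)) ∧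
      (∀ n : ℤ, (N : ℤ) < |n| → inner ℂ (psi n) K ≠ 0 →
          ∃ lam : ℂ, lam ∈ Metric.ball (n : ℂ) ‖inner ℂ (psi n) K‖ ∧
            IsEigenvalue (P1 K) lam ∧ algMult (P1 K) lam = 1 ∧
            ∀ z ∈ Metric.ball (n : ℂ) ‖inner ℂ (psi n) K‖, IsEigenvalue (P1 K) z → z = lam) ∧
      (∀ n : ℤ, (N : ℤ) < |n| → inner ℂ (psi n) K = 0 →
          IsEigenvalue (P1 K) (n : ℂ) ∧ algMult (P1 K) (n : ℂ) = 1) ∧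
      (∀ lam : ℂ, IsEigenvalue (P1 K) lam →
          lam ∈ rect N b ∨
          (∃ n : ℤ, (N : ℤ) < |n| ∧ inner ℂ (psi n) K ≠ 0 ∧
            lam ∈ Metric.ball (n : ℂ) ‖inner ℂ (psi n) K‖) ∨
          (∃ n : ℤ, (N : ℤ) < |n| ∧ inner ℂ (psi n) K = 0 ∧ lam = (n : ℂ))) := by
  obtain ⟨δ, hδ, hδ', M, hM⟩ := exists_local_zeros K
  obtain ⟨R, hR, hz⟩ := exists_zeros_near_intCast K.integrable hδ
  have hz1 : ∀ z : ℂ, R ≤ ‖z‖ → charFn K z = 0 → ∃ n : ℤ, ‖z - n‖ < δ := by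
    simpa using hz 1 (by simp)
  -- `N, b ≥ R` put all uncontrolled zeros, those with `‖z‖ < R`, into the rectangle; `b ≥ 1 > δ`
  -- does so for those near integers `|n| ≤ N`.
  refine ⟨⌈max M R⌉₊, max R 1, by positivity, fun N hN b hb => ?_⟩
  have hN' : max M R ≤ N := (Nat.le_ceil _).trans (by exact_mod_cast hN)
  have hMN : M ≤ N := (le_max_left _ _).trans hN'
  have hRN : R ≤ N := (le_max_right _ _).trans hN'
  have hRb : R ≤ b := (le_max_left _ _).trans hb
  have h1b : 1 ≤ b := (le_max_right _ _).trans hb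
  have hloc : ∀ n : ℤ, (N : ℤ) < |n| → M ≤ |(n : ℝ)| := fun n hn => by
    have : (N : ℝ) < |(n : ℝ)| := by exact_mod_cast hn
    linarith
  have hsmall : ∀ z : ℂ, ‖z‖ < R → z ∈ rect N b := fun z hzR =>
    ⟨by linarith [Complex.abs_re_le_norm z], by linarith [Complex.abs_im_le_norm z]⟩
  have hnear : ∀ (z : ℂ) (n : ℤ), ‖z - n‖ < δ → |(n : ℝ)| ≤ N → z ∈ rect N b := by
    intro z n hzn hn
    have h1 : |z.re - n| ≤ ‖z - n‖ := by simpa using Complex.abs_re_le_norm (z - n)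
    have h2 : |z.im| ≤ ‖z - n‖ := by simpa using Complex.abs_im_le_norm (z - n)
    have h3 := abs_sub_abs_le_abs_sub z.re n
    exact ⟨by linarith, by linarith⟩
  refine ⟨?_, fun n hn hk => ?_, fun n hn hk => ?_, fun lam hlam => ?_⟩
  · have hD := differentiable_charFn K.integrable
    -- The rectangle and the disk of radius `N + 7/10` contain the same zeros, because large zeros
    -- lie within `1/10` of an integer; so the count may be done in the disk.
    have hfin := hD.finite_zeros (analyticOrderAt_charFn_ne_top K.integrable) (N + 7 / 10)
    have hS : ∀ z, z ∈ hfin.toFinset ↔ ‖z‖ ≤ N + 7 / 10 ∧ charFn K z = 0 := fun z => by simp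
    refine ⟨hfin.toFinset, fun lam => ?_, ?_⟩
    · rw [hS, isEigenvalue_P1_iff, and_comm]
      refine and_congr_right fun h0 => ?_
      rcases lt_or_ge ‖lam‖ R with h | h
      · exact iff_of_true (by linarith) (hsmall lam h)
      · obtain ⟨n, hn⟩ := hz1 lam h h0
        have h1 := abs_lt.1 (abs_norm_sub_abs_intCast_lt hn)
        rcases abs_intCast_le_or n N with h2 | ⟨h2, -⟩
        · exact iff_of_true (by linarith) (hnear lam n hn h2)
        · refine iff_of_false (fun h3 => by linarith) fun h3 => ?_
          have h4 : |lam.re - n| ≤ ‖lam - n‖ := by simpa using Complex.abs_re_le_norm (lam - n)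
          have h5 := abs_sub_abs_le_abs_sub (n : ℝ) lam.re
          rw [abs_sub_comm] at h5
          linarith [h3.1]
    · rw [Finset.sum_congr rfl fun lam hlam =>
        algMult_P1_eq_analyticOrderNatAt K ((hS lam).1 hlam).2, ← Nat.cast_sum,
        sum_analyticOrderNatAt_charFn K.integrable (fun s hs z h1 h2 h0 => ?_) hS]
      -- A zero within `1/10` of an integer has modulus within `1/10` of a natural number, hence
      -- outside `[N + 3/10, N + 7/10]`.
      obtain ⟨n, hn⟩ := hz s hs z (by linarith) h0
      have h3 := abs_lt.1 (abs_norm_sub_abs_intCast_lt hn)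
      rcases abs_intCast_le_or n N with h4 | ⟨h4, -⟩ <;> linarith
  · obtain ⟨h1, lam, h2, h3, h4, h5⟩ := hM n (hloc n hn)
    have hk' : 0 < ‖(inner ℂ (psi n) K : ℂ)‖ := norm_pos_iff.2 hk
    refine ⟨lam, ?_, (isEigenvalue_P1_iff K lam).2 h3, ?_, fun z hzb hze => ?_⟩
    · rw [mem_ball_iff_norm]
      linarith
    · rw [algMult_P1_eq_analyticOrderNatAt K h3, h4, Nat.cast_one]
    -- The disk of radius `|⟨ψ_n, K⟩| < δ` lies inside the uniqueness ball.
    · exact h5 z (Metric.ball_subset_ball h1.le hzb) ((isEigenvalue_P1_iff K z).1 hze)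
  · obtain ⟨h1, lam, h2, h3, h4, h5⟩ := hM n (hloc n hn)
    -- A vanishing Fourier coefficient forces the nearby zero to be `n` itself.
    rw [hk, norm_zero, zero_div, norm_le_zero_iff, sub_eq_zero] at h2
    subst h2
    exact ⟨(isEigenvalue_P1_iff K _).2 h3, by
      rw [algMult_P1_eq_analyticOrderNatAt K h3, h4, Nat.cast_one]⟩
  · rw [isEigenvalue_P1_iff] at hlam
    rcases lt_or_ge ‖lam‖ R with h | h
    · exact Or.inl (hsmall lam h)
    · obtain ⟨n, hn⟩ := hz1 lam h hlam
      rcases abs_intCast_le_or n N with h2 | ⟨-, h2⟩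
      · exact Or.inl (hnear lam n hn h2)
      · right
        obtain ⟨h1, z, h3, -, -, h5⟩ := hM n (hloc n h2)
        rw [← h5 lam (by rwa [mem_ball_iff_norm]) hlam] at h3
        by_cases hk : (inner ℂ (psi n) K : ℂ) = 0
        · right
          rw [hk, norm_zero, zero_div, norm_le_zero_iff, sub_eq_zero] at h3
          exact ⟨n, h2, hk, h3⟩
        · left
          have hk' : 0 < ‖(inner ℂ (psi n) K : ℂ)‖ := norm_pos_iff.2 hk
          refine ⟨n, h2, hk, ?_⟩
          rw [mem_ball_iff_norm]
          linarith
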